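/- Let $m\le n$, let $A\in\mathbb R^{m\times n}$ have rank $r$ and singular value decomposition $A=\sum_{i=1}^r\sigma_iu_iv_i^\top$ with $\sigma_1\ge\dots\ge\sigma_r>0$ and $\sigma_{r+1}:=0$. Let $1\le p\le r$ and assume $\delta_p:=\sigma_p-\sigma_{p+1}>0$. For any matrix $M$ let $M_p$ be the best rank-$p$ approximation obtained by keeping the $p$ largest singular values in a singular value decomposition of $M$ (so $M_p=M$ if $M$ has rank at most $p$), and let $\|\cdot\|$ be the spectral norm. Let $E=(\xi_{ij})$ be an $m\times n$ random real matrix whose entries are independent with mean zero and variances $\sigma_{ij}^2$, and which is $(K,\sigma)$-bounded: almost surely $|\xi_{ij}|\le K$ for all $i,j$, and $\sigma_{ij}^2\le\sigma^2$ for all $i,j$. Put $\tilde A=A+E$, $$\varepsilon_1=\frac{\|E\|}{\sigma_p},\qquad \varepsilon_2=\frac1{\delta_p},\qquad \eta=\frac{\|E\|^2}{\sigma_p\delta_p},$$ $$m_4=\max_{1\le k\le n,\ 1\le l\le m}\Big\{\frac1m\sum_{i=1}^m\sigma_{ik}^4,\ \frac1n\sum_{j=1}^n\sigma_{lj}^4\Big\},\qquad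 \mu=\max_{1\le k<l\le r}\Big(\big|\mathbf E(Ev_k\cdot Ev_l)\big|+\big|\mathbf E(E^\top u_k\cdot E^\top u_l)\big|\Big),$$ where $\mu:=0$ if $r=1$. For $t_1>0$ let (C0) be the condition $$\max\big\{p\varepsilon_1,\ r^2t_1\varepsilon_2,\ \sqrt{r\eta}\big\}\le\frac1{96}.$$ Theorem. For all $t_1>0$ and $t_2>0$, there is an event of probability at least $$1-r^2\exp\Big(\frac{-t_1^2/2}{2\sigma^2+Kt_1}\Big)-\frac{5r(r-1)\,n\,m_4}{2t_2^2}$$ on which, whenever (C0) holds for $t_1$, $$\|\tilde A_p-A_p\|\le 32\,\sigma_p\Big(\varepsilon_1+r\,t_1\,\varepsilon_2+\frac{r^2(t_2+\mu)}{\|E\|}\,\varepsilon_1\varepsilon_2\Big).$$ In particular, if (C0) holds almost surely, then this bound holds with at least the stated probability. (If $E=0$ the last summand is read as $0$; if $2\sigma^2+Kt_1=0$ the exponential is read as $1$.) -/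

import Mathlib

open MeasureTheory ProbabilityTheory
open scoped Matrix InnerProductSpace Matrix.Norms.L2Operator

noncomputable section

namespace LowRankPerturbation

variable {m n : ℕ}

/-- The `k`-th singular value of `M` in decreasing order, counted from `k = 1`; it is `0` for `k`
larger than the rank. (Mathlib counts the singular values from `0`.) -/
def sval (M : Matrix (Fin m) (Fin n) ℝ) (k : ℕ) : ℝ :=
  (Matrix.toEuclideanLin M).singularValues (k - 1)

/-- The singular value gap `δ_k = σ_k - σ_{k+1}`. -/
def gap (M : Matrix (Fin m) (Fin n) ℝ) (k : ℕ) : ℝ :=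
  sval M k - sval M (k + 1)

/-- A singular value decomposition `M = ∑_{i = 1}^r σ_i u_i v_iᵀ`, where `r` is the rank of `M`.
The vectors `u_i`, `v_i` are indexed by `Fin r`, so that the index `i : Fin r` stands for the
position `i + 1`. -/
structure SVD (M : Matrix (Fin m) (Fin n) ℝ) where
  u : Fin M.rank → EuclideanSpace ℝ (Fin m)
  v : Fin M.rank → EuclideanSpace ℝ (Fin n)
  orthonormal_u : Orthonormal ℝ u
  orthonormal_v : Orthonormal ℝ v
  eq_sum : M = ∑ i : Fin M.rank, sval M (i + 1) • Matrix.vecMulVec (u i).ofLp (v i).ofLp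

/-- The best rank `p` approximation `M_p = ∑_{i = 1}^p σ_i u_i v_iᵀ`
(all of `M` if `p` is at least the rank). -/
def SVD.approx {M : Matrix (Fin m) (Fin n) ℝ} (S : SVD M) (p : ℕ) : Matrix (Fin m) (Fin n) ℝ :=
  ∑ i : Fin M.rank with i.val < p, sval M (i + 1) • Matrix.vecMulVec (S.u i).ofLp (S.v i).ofLp

/-- Every real matrix has a singular value decomposition. -/
theorem SVD.nonempty (M : Matrix (Fin m) (Fin n) ℝ) : Nonempty (SVD M) := by
  classical
  set T := Matrix.toEuclideanLin M with hT
  have hfin : Module.finrank ℝ (EuclideanSpace ℝ (Fin n)) = n := by simp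
  have hr : M.rank = Module.finrank ℝ (LinearMap.range T) := by
    rw [hT, Matrix.toEuclideanLin, Matrix.toLpLin_eq_toLin]
    exact Matrix.rank_eq_finrank_range_toLin M _ _
  have hrn : M.rank ≤ n := by simpa using M.rank_le_card_width
  have hs : T.isSymmetric_adjoint_comp_self.eigenvalues hfin =
      fun i : Fin n => T.singularValues i ^ 2 := by
    funext i
    exact (T.sq_singularValues_fin hfin i).symm
  set b := T.isSymmetric_adjoint_comp_self.eigenvectorBasis hfin with hb
  have hinner : ∀ i j : Fin n, inner ℝ (T (b i)) (T (b j)) =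
      if i = j then T.singularValues j ^ 2 else 0 := by
    intro i j
    rw [← LinearMap.adjoint_inner_right, ← LinearMap.comp_apply, hb,
      LinearMap.IsSymmetric.apply_eigenvectorBasis, inner_smul_right, ← hb,
      orthonormal_iff_ite.mp b.orthonormal, congrFun hs j]
    simp
  have hpos : ∀ i : Fin M.rank, 0 < T.singularValues i := fun i =>
    T.singularValues_pos_iff_lt_finrank_range.mpr (hr ▸ i.isLt)
  let c : Fin M.rank → Fin n := Fin.castLE hrn
  have hc : Function.Injective c := Fin.castLE_injective hrn
  refine ⟨⟨fun i => (T.singularValues i)⁻¹ • T (b (c i)), fun i => b (c i), ?_,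
    b.orthonormal.comp c hc, ?_⟩⟩
  · rw [orthonormal_iff_ite]
    intro i j
    rw [inner_smul_left, inner_smul_right, hinner]
    by_cases h : i = j
    · subst h
      have := (hpos i).ne'
      simp [c]
      field_simp
    · simp [h, hc.ne h]
  · apply (Matrix.toEuclideanLin (𝕜 := ℝ) (m := Fin m) (n := Fin n)).injective
    apply b.toBasis.ext
    intro j
    rw [← hT, map_sum, LinearMap.sum_apply, OrthonormalBasis.coe_toBasis]
    have hterm : ∀ i : Fin M.rank, (Matrix.toEuclideanLin (sval M (i + 1) •
        Matrix.vecMulVec ((T.singularValues i)⁻¹ • T (b (c i))).ofLp (b (c i)).ofLp)) (b j)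
        = if c i = j then T (b (c i)) else 0 := by
      intro i
      have h1 : (b (c i)).ofLp ⬝ᵥ (b j).ofLp = if c i = j then 1 else 0 := by
        rw [← orthonormal_iff_ite.mp b.orthonormal, EuclideanSpace.inner_eq_star_dotProduct]
        simp [dotProduct_comm]
      have h2 := (hpos i).ne'
      rw [map_smul, LinearMap.smul_apply, Matrix.toLpLin_apply, Matrix.vecMulVec_mulVec, h1]
      ext k
      by_cases h : c i = j
      · simp [h, sval, ← hT]
        field_simp
      · simp [h]
    rw [Finset.sum_congr rfl fun i _ => hterm i]
    by_cases hj : j.val < M.rank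
    · have hcj : ∀ i : Fin M.rank, c i = j ↔ i = ⟨j, hj⟩ := by
        intro i
        simp [c, Fin.ext_iff]
      simp only [hcj]
      simp [c]
    · have h0 : T (b j) = 0 := by
        have h3 := hinner j j
        rw [if_pos rfl, T.singularValues_eq_zero_iff_le_finrank_range.mpr (by omega)] at h3
        exact inner_self_eq_zero.mp (h3.trans (by norm_num))
      rw [h0, Finset.sum_eq_zero]
      intro i _
      rw [if_neg]
      intro h
      exact hj (by rw [← h]; exact i.isLt)

/-- `ε₁ = ‖E‖ / σ_p`. -/
def eps₁ (A E : Matrix (Fin m) (Fin n) ℝ) (p : ℕ) : ℝ := ‖E‖ / sval A p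

/-- `ε₂ = 1 / δ_p`. -/
def eps₂ (A : Matrix (Fin m) (Fin n) ℝ) (p : ℕ) : ℝ := 1 / gap A p

/-- `η = ‖E‖² / (σ_p δ_p)`. -/
def eta (A E : Matrix (Fin m) (Fin n) ℝ) (p : ℕ) : ℝ := ‖E‖ ^ 2 / (sval A p * gap A p)

/-- Condition C0: `max {p ε₁, r² t₁ ε₂, √(r η)} ≤ 1/96`, for a given value `E` of the noise. -/
def CondC0 (A E : Matrix (Fin m) (Fin n) ℝ) (p : ℕ) (t₁ : ℝ) : Prop :=
  max (max (p * eps₁ A E p) ((A.rank : ℝ) ^ 2 * t₁ * eps₂ A p)) (√(A.rank * eta A E p)) ≤ 1 / 96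

variable {Ω : Type*} [MeasurableSpace Ω]

/-- `E` is a random matrix with independent `(K, σ)`-bounded entries of mean zero. -/
structure IsBoundedNoise (P : Measure Ω) (E : Ω → Matrix (Fin m) (Fin n) ℝ) (K σ : ℝ) : Prop where
  measurable : ∀ i j, Measurable fun ω => E ω i j
  indep : iIndepFun (fun (a : Fin m × Fin n) ω => E ω a.1 a.2) P
  mean_zero : ∀ i j, ∫ ω, E ω i j ∂P = 0
  bounded : ∀ᵐ ω ∂P, ∀ i j, |E ω i j| ≤ K
  variance_le : ∀ i j, Var[fun ω => E ω i j; P] ≤ σ ^ 2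

/-- `m₄`, the largest of the averages of `σ_{ij}⁴` along a column or a row, where `σ_{ij}²` is the
variance of the entry `(i, j)`. -/
def mFour (P : Measure Ω) (E : Ω → Matrix (Fin m) (Fin n) ℝ) : ℝ :=
  max (⨆ k : Fin n, 1 / (m : ℝ) * ∑ i : Fin m, Var[fun ω => E ω i k; P] ^ 2)
    (⨆ l : Fin m, 1 / (n : ℝ) * ∑ j : Fin n, Var[fun ω => E ω l j; P] ^ 2)

/-- `μ = max_{k < l} (|𝔼(E v_k · E v_l)| + |𝔼(Eᵀ u_k · Eᵀ u_l)|)`, which is `0` if there are no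
pairs `k < l`. -/
def meanSkew (P : Measure Ω) (E : Ω → Matrix (Fin m) (Fin n) ℝ) {A : Matrix (Fin m) (Fin n) ℝ}
    (S : SVD A) : ℝ :=
  ⨆ a : {a : Fin A.rank × Fin A.rank // a.1 < a.2},
    (|∫ ω, (E ω *ᵥ (S.v a.1.1).ofLp) ⬝ᵥ (E ω *ᵥ (S.v a.1.2).ofLp) ∂P| +
      |∫ ω, ((E ω)ᵀ *ᵥ (S.u a.1.1).ofLp) ⬝ᵥ ((E ω)ᵀ *ᵥ (S.u a.1.2).ofLp) ∂P|)

end LowRankPerturbation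

end

/-! The argument joins a deterministic perturbation bound to tail estimates for the few features of
`E` that it uses: e = ‖E‖, a bound t for the entries ⟪u_l, E v_k⟫, and a bound y for the
off-diagonal Gram entries of the vectors E v_k and of the vectors Eᵀ u_k.

Deterministic part. For k ≤ p, correct u_k and v_k to second order by vectors orthogonal to all u_l
and v_l. Then A + E maps the corrected v_k to (s_k + d) times the corrected u_k, with d ≥ 0, up to a
residual R of order √r (t + (y + r t²)/σ_p) + e³/σ_p² (`residual_le`); Eᵀ does the same in the other
direction. Off its leading p singular spaces A + E has norm at most θ = σ_p - δ_p/2. Weyl's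
inequality would need ‖E‖ to be small against δ_p, whereas (C0) controls only ‖E‖²/(σ_p δ_p);
`singularValue_le` replaces it by a bound in which e enters through its square. Projecting both
equations onto the complements of the leading spaces of A + E gives two coupled inequalities, whose
solution bounds the misalignment of the spaces by about σ_p R/δ_p (`singular_subspace_bound`).
`norm_truncation_sub_le` turns this into a bound for the difference of the truncations.

Probabilistic part. The bilinear entries have Bernstein tails. A Gram entry is a quadratic form in
the noise. Its off-diagonal part has second moment controlled by m₄ (`integral_chaos_sq_le`), so
Chebyshev gives t₂. Its diagonal part involves fourth moments of the entries, which m₄ does not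
control; it is bounded exponentially at level t₁ σ_p, on the event ‖E‖ ≤ σ_p/96 that (C0) provides
(`measureReal_diagonal_le`). In the final bound this level only contributes to the term r t₁ ε₂. -/

namespace LowRankPerturbation

/-! ### Finite-rank operators and projections in orthonormal families -/

section Operators

variable {V W X ι κ : Type*} [NormedAddCommGroup V] [InnerProductSpace ℝ V]
  [NormedAddCommGroup W] [InnerProductSpace ℝ W] [NormedAddCommGroup X] [InnerProductSpace ℝ X]
  [Fintype ι] [Fintype κ]

/-- The operator `∑ i, s i u_i v_iᵀ`. -/
noncomputable def lowRank (s : ι → ℝ) (u : ι → W) (v : ι → V) : V →L[ℝ] W :=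
  ∑ i, s i • (innerSL ℝ (v i)).smulRight (u i)

theorem lowRank_apply (s : ι → ℝ) (u : ι → W) (v : ι → V) (z : V) :
    lowRank s u v z = ∑ i, (s i * ⟪v i, z⟫_ℝ) • u i := by
  simp [lowRank, smul_smul]

theorem inner_lowRank_right (s : ι → ℝ) (u : ι → W) (v : ι → V) (w : W) (z : V) :
    ⟪w, lowRank s u v z⟫_ℝ = ∑ i, s i * ⟪u i, w⟫_ℝ * ⟪v i, z⟫_ℝ := by
  rw [lowRank_apply, inner_sum]
  refine Finset.sum_congr rfl fun i _ => ?_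
  rw [inner_smul_right, real_inner_comm w]
  ring

theorem inner_lowRank_comm (s : ι → ℝ) (u : ι → W) (v : ι → V) (w : W) (z : V) :
    ⟪lowRank s v u w, z⟫_ℝ = ⟪w, lowRank s u v z⟫_ℝ := by
  rw [real_inner_comm, inner_lowRank_right, inner_lowRank_right]
  exact Finset.sum_congr rfl fun i _ => by ring

theorem adjoint_lowRank [CompleteSpace V] [CompleteSpace W]
    (s : ι → ℝ) (u : ι → W) (v : ι → V) :
    ContinuousLinearMap.adjoint (lowRank s u v) = lowRank s v u := by
  symm
  rw [ContinuousLinearMap.eq_adjoint_iff]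
  intro w z
  exact inner_lowRank_comm s u v w z

theorem inner_sum_smul {u : ι → W} (hu : Orthonormal ℝ u) (c : ι → ℝ) (i : ι) :
    ⟪u i, ∑ j, c j • u j⟫_ℝ = c i :=
  hu.inner_right_fintype c i

theorem inner_lowRank {u : ι → W} (hu : Orthonormal ℝ u) (s : ι → ℝ) (v : ι → V) (i : ι) (z : V) :
    ⟪u i, lowRank s u v z⟫_ℝ = s i * ⟪v i, z⟫_ℝ := by
  rw [lowRank_apply, inner_sum_smul hu]

theorem lowRank_lowRank {v : ι → V} (hv : Orthonormal ℝ v) (a b : ι → ℝ) (u : ι → W) (w : ι → X)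
    (z : X) : lowRank a u v (lowRank b v w z) = lowRank (a * b) u w z := by
  rw [lowRank_apply, lowRank_apply (a * b)]
  refine Finset.sum_congr rfl fun i _ => ?_
  rw [inner_lowRank hv]
  simp [mul_assoc]

theorem lowRank_apply_self {v : ι → V} (hv : Orthonormal ℝ v) (s : ι → ℝ) (u : ι → W) (i : ι) :
    lowRank s u v (v i) = s i • u i := by
  classical
  rw [lowRank_apply, Finset.sum_eq_single i]
  · rw [real_inner_self_eq_norm_sq, hv.1 i]; simp
  · intro j _ hj
    rw [hv.2 hj]; simp
  · simp

theorem norm_sum_smul_sq {u : ι → W} (hu : Orthonormal ℝ u) (c : ι → ℝ) :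
    ‖∑ i, c i • u i‖ ^ 2 = ∑ i, c i ^ 2 := by
  rw [← real_inner_self_eq_norm_sq, hu.inner_sum]
  simp [pow_two]

theorem norm_sum_smul_le {u : ι → W} (hu : Orthonormal ℝ u) {c : ι → ℝ} {b : ℝ} (hb : 0 ≤ b)
    (hc : ∀ i, |c i| ≤ b) : ‖∑ i, c i • u i‖ ≤ √(Fintype.card ι) * b := by
  refine le_of_sq_le_sq ?_ (by positivity)
  rw [norm_sum_smul_sq hu, mul_pow, Real.sq_sqrt (by positivity)]
  calc ∑ i, c i ^ 2 ≤ ∑ _i : ι, b ^ 2 := Finset.sum_le_sum fun i _ => sq_le_sq' (by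
        linarith [neg_le_of_abs_le (hc i)]) (le_of_abs_le (hc i))
    _ = _ := by simp

theorem sum_inner_sq_le {v : ι → V} (hv : Orthonormal ℝ v) (z : V) :
    ∑ i, ⟪v i, z⟫_ℝ ^ 2 ≤ ‖z‖ ^ 2 := by
  simpa using hv.sum_inner_products_le z (s := Finset.univ)

theorem norm_lowRank_le {u : ι → W} {v : ι → V} (hu : Orthonormal ℝ u) (hv : Orthonormal ℝ v)
    {s : ι → ℝ} {c : ℝ} (hc : 0 ≤ c) (hs : ∀ i, |s i| ≤ c) (z : V) :
    ‖lowRank s u v z‖ ≤ c * ‖z‖ := by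
  refine le_of_sq_le_sq ?_ (by positivity)
  rw [lowRank_apply, norm_sum_smul_sq hu, mul_pow]
  calc ∑ i, (s i * ⟪v i, z⟫_ℝ) ^ 2 ≤ ∑ i, c ^ 2 * ⟪v i, z⟫_ℝ ^ 2 := by
        refine Finset.sum_le_sum fun i _ => ?_
        rw [mul_pow]
        refine mul_le_mul_of_nonneg_right ?_ (sq_nonneg _)
        exact sq_le_sq' (by linarith [neg_le_of_abs_le (hs i)]) (le_of_abs_le (hs i))
    _ = c ^ 2 * ∑ i, ⟪v i, z⟫_ℝ ^ 2 := by rw [Finset.mul_sum]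
    _ ≤ _ := by gcongr; exact sum_inner_sq_le hv z

/-- The orthogonal projection onto the span of `u`, for orthonormal `u`. -/
noncomputable def proj (u : ι → W) : W →L[ℝ] W := lowRank (fun _ => 1) u u

theorem proj_apply (u : ι → W) (w : W) : proj u w = ∑ i, ⟪u i, w⟫_ℝ • u i := by
  simp [proj, lowRank_apply]

theorem inner_proj {u : ι → W} (hu : Orthonormal ℝ u) (i : ι) (w : W) :
    ⟪u i, proj u w⟫_ℝ = ⟪u i, w⟫_ℝ := by
  simp [proj, inner_lowRank hu]

theorem inner_sub_proj {u : ι → W} (hu : Orthonormal ℝ u) (i : ι) (w : W) :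
    ⟪u i, w - proj u w⟫_ℝ = 0 := by
  rw [inner_sub_right, inner_proj hu, sub_self]

theorem inner_sub_proj_right {u : ι → W} (hu : Orthonormal ℝ u) (w z : W) :
    ⟪z, w - proj u w⟫_ℝ = ⟪z - proj u z, w - proj u w⟫_ℝ := by
  have : ⟪proj u z, w - proj u w⟫_ℝ = 0 := by
    rw [proj_apply, sum_inner]
    exact Finset.sum_eq_zero fun i _ => by rw [real_inner_smul_left, inner_sub_proj hu, mul_zero]
  rw [inner_sub_left, this, sub_zero]

theorem norm_proj_sq_add {u : ι → W} (hu : Orthonormal ℝ u) (w : W) :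
    ‖proj u w‖ ^ 2 + ‖w - proj u w‖ ^ 2 = ‖w‖ ^ 2 := by
  have h : ⟪proj u w, w - proj u w⟫_ℝ = 0 := by
    rw [proj_apply u w, sum_inner]
    refine Finset.sum_eq_zero fun i _ => ?_
    rw [← proj_apply, real_inner_smul_left, inner_sub_proj hu, mul_zero]
  have := norm_add_sq_eq_norm_sq_add_norm_sq_of_inner_eq_zero _ _ h
  rw [add_sub_cancel] at this
  nlinarith [this]

theorem norm_proj_le {u : ι → W} (hu : Orthonormal ℝ u) (w : W) : ‖proj u w‖ ≤ ‖w‖ :=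
  le_of_sq_le_sq (by nlinarith [norm_proj_sq_add hu w, sq_nonneg ‖w - proj u w‖]) (norm_nonneg _)

theorem norm_sub_proj_le {u : ι → W} (hu : Orthonormal ℝ u) (w : W) :
    ‖w - proj u w‖ ≤ ‖w‖ :=
  le_of_sq_le_sq (by nlinarith [norm_proj_sq_add hu w, sq_nonneg ‖proj u w‖]) (norm_nonneg _)

theorem lowRank_sub_proj {v : ι → V} (hv : Orthonormal ℝ v) (s : ι → ℝ) (u : ι → W) (z : V) :
    lowRank s u v (z - proj v z) = 0 := by
  rw [lowRank_apply]
  exact Finset.sum_eq_zero fun i _ => by rw [inner_sub_proj hv]; simp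

end Operators

/-! ### A Weyl inequality of second order -/

section SingularValueBound

variable {V W : Type*} [NormedAddCommGroup V] [InnerProductSpace ℝ V]
  [NormedAddCommGroup W] [InnerProductSpace ℝ W]

theorem sum_abs_inner_le {ι : Type*} [Fintype ι] {u : ι → W} (hu : Orthonormal ℝ u) (a : W) :
    ∑ i, |⟪u i, a⟫_ℝ| ≤ √(Fintype.card ι) * ‖proj u a‖ := by
  refine le_of_sq_le_sq ?_ (by positivity)
  rw [mul_pow, Real.sq_sqrt (by positivity), proj_apply, norm_sum_smul_sq hu]
  have := sq_sum_le_card_mul_sum_sq (s := Finset.univ) (f := fun i => |⟪u i, a⟫_ℝ|)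
  simpa using this

/-- An entrywise bound t makes the compressed block of `E` at most t times the product of the two ℓ¹
norms of coefficients; Cauchy–Schwarz costs the square roots of the two dimensions. -/
theorem inner_proj_map_proj_le {ι κ : Type*} [Fintype ι] [Fintype κ] {u : ι → W} {v : κ → V}
    (hu : Orthonormal ℝ u) (hv : Orthonormal ℝ v) (E : V →L[ℝ] W) {t : ℝ} (ht : 0 ≤ t)
    (hx : ∀ l k, |⟪u l, E (v k)⟫_ℝ| ≤ t) (a : W) (b : V) :
    ⟪proj u a, E (proj v b)⟫_ℝ ≤
      t * (√(Fintype.card ι) * ‖proj u a‖) * (√(Fintype.card κ) * ‖proj v b‖) := by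
  have hexp : ⟪proj u a, E (proj v b)⟫_ℝ =
      ∑ l, ∑ k, ⟪u l, a⟫_ℝ * ⟪v k, b⟫_ℝ * ⟪u l, E (v k)⟫_ℝ := by
    rw [proj_apply, proj_apply, map_sum, sum_inner]
    refine Finset.sum_congr rfl fun l _ => ?_
    rw [inner_sum]
    refine Finset.sum_congr rfl fun k _ => ?_
    rw [map_smul, inner_smul_right, real_inner_smul_left]
    ring
  calc ⟪proj u a, E (proj v b)⟫_ℝ
      ≤ ∑ l, ∑ k, t * (|⟪u l, a⟫_ℝ| * |⟪v k, b⟫_ℝ|) := by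
        rw [hexp]
        refine Finset.sum_le_sum fun l _ => Finset.sum_le_sum fun k _ => ?_
        refine (le_abs_self _).trans ?_
        rw [abs_mul, abs_mul, mul_comm]
        gcongr
        exact hx l k
    _ = t * (∑ l, |⟪u l, a⟫_ℝ|) * ∑ k, |⟪v k, b⟫_ℝ| := by
        rw [mul_assoc, Finset.sum_mul_sum, Finset.mul_sum]
        simp_rw [Finset.mul_sum]
    _ ≤ _ := by
        gcongr
        · exact sum_abs_inner_le hu a
        · exact sum_abs_inner_le hv b

theorem quadratic_cross_le {κ τ e x y : ℝ} (hκ : e ^ 2 ≤ κ * τ) (hτ : 0 < τ) :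
    2 * e * (x * y) ≤ κ * x ^ 2 + τ * y ^ 2 := by
  have h : 0 ≤ τ * (κ * x ^ 2 + τ * y ^ 2 - 2 * e * (x * y)) := by
    nlinarith [sq_nonneg (e * x - τ * y), mul_le_mul_of_nonneg_right hκ (sq_nonneg x)]
  nlinarith [nonneg_of_mul_nonneg_right h hτ]

/-- A Weyl type bound for the singular values of `∑ s_i u_i v_iᵀ + E`, of second order in `‖E‖`. -/
theorem singularValue_le {r r' p : ℕ} (hpr : p ≤ r) {s : Fin r → ℝ} {u : Fin r → W} {v : Fin r → V}
    (hu : Orthonormal ℝ u) (hv : Orthonormal ℝ v) {s' : Fin r' → ℝ} {u' : Fin r' → W}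
    {v' : Fin r' → V} (hu' : Orthonormal ℝ u') (hv' : Orthonormal ℝ v') (hs' : Antitone s')
    (hs : ∀ i, 0 ≤ s i) {s₁ : ℝ} (hs₁ : 0 ≤ s₁) (hsp : ∀ i : Fin r, p ≤ i.val → s i ≤ s₁)
    {E : V →L[ℝ] W} (hM : lowRank s' u' v' = lowRank s u v + E) {e t θ : ℝ} (ht : 0 ≤ t)
    (hE : ∀ z, ‖E z‖ ≤ e * ‖z‖) (he : 0 ≤ e) (hx : ∀ l k, |⟪u l, E (v k)⟫_ℝ| ≤ t)
    (hθe : e < θ) (hθ : e ^ 2 ≤ (θ - s₁ - r * t) * (θ - e)) (j : Fin r') (hj : p ≤ j.val) :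
    s' j ≤ θ := by
  by_contra hlt
  push Not at hlt
  let c₀ : Fin (p + 1) → Fin r' := Fin.castLE (by omega)
  have hc₀ : Function.Injective c₀ := Fin.castLE_injective _
  let d₀ : Fin p → Fin r := Fin.castLE hpr
  -- Courant–Fischer for the self-adjoint dilation: p linear conditions on p + 1 coefficients. The
  -- same coefficients `c` serve for `a` and `b`, and a kernel element makes ⟪u_k, a⟫ = -⟪v_k, b⟫
  -- for k < p.
  let φ : (Fin (p + 1) → ℝ) →ₗ[ℝ] (Fin p → ℝ) :=
    { toFun := fun c k => ∑ i, c i * (⟪u (d₀ k), u' (c₀ i)⟫_ℝ + ⟪v (d₀ k), v' (c₀ i)⟫_ℝ)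
      map_add' := by
        intro x y
        ext k
        simp [add_mul, Finset.sum_add_distrib]
      map_smul' := by
        intro x y
        ext k
        simp [Finset.mul_sum, mul_assoc] }
  have hker : LinearMap.ker φ ≠ ⊥ := LinearMap.ker_ne_bot_of_finrank_lt (by simp)
  obtain ⟨c, hc, hc0⟩ := (Submodule.ne_bot_iff _).mp hker
  set a : W := ∑ i, c i • u' (c₀ i) with ha
  set b : V := ∑ i, c i • v' (c₀ i) with hb
  have hcpos : 0 < ∑ i, c i ^ 2 := by
    obtain ⟨i, hi⟩ := Function.ne_iff.mp hc0
    exact Finset.sum_pos' (fun _ _ => sq_nonneg _) ⟨i, Finset.mem_univ _, by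
      have : c i ≠ 0 := hi
      positivity⟩
  have hna : ‖a‖ ^ 2 = ∑ i, c i ^ 2 := norm_sum_smul_sq (hu'.comp c₀ hc₀) c
  have hnb : ‖b‖ ^ 2 = ∑ i, c i ^ 2 := norm_sum_smul_sq (hv'.comp c₀ hc₀) c
  have hlow : θ * ∑ i, c i ^ 2 < ⟪a, lowRank s' u' v' b⟫_ℝ := by
    have h1 : lowRank s' u' v' b = ∑ i, (s' (c₀ i) * c i) • u' (c₀ i) := by
      rw [hb, map_sum]
      refine Finset.sum_congr rfl fun i _ => ?_
      rw [map_smul, lowRank_apply_self hv', smul_smul, mul_comm]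
    have h2 := (hu'.comp c₀ hc₀).inner_sum c (fun i => s' (c₀ i) * c i) Finset.univ
    simp only [Function.comp_apply, conj_trivial] at h2
    rw [h1, ha, h2, Finset.mul_sum]
    obtain ⟨i, hi⟩ := Function.ne_iff.mp hc0
    have hgt : ∀ i, θ < s' (c₀ i) := fun i => hlt.trans_le (hs' (by
      rw [Fin.le_def]; simp [c₀]; omega))
    refine Finset.sum_lt_sum (fun i _ => ?_) ⟨i, Finset.mem_univ _, ?_⟩
    · nlinarith [hgt i, sq_nonneg (c i)]
    · have : c i ≠ 0 := hi
      have : 0 < c i ^ 2 := by positivity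
      nlinarith [hgt i]
  have hopp : ∀ k : Fin r, k.val < p → ⟪u k, a⟫_ℝ = - ⟪v k, b⟫_ℝ := by
    intro k hk
    have h1 := congrFun (LinearMap.mem_ker.mp hc) ⟨k, hk⟩
    have h2 : d₀ ⟨k, hk⟩ = k := rfl
    simp only [φ, LinearMap.coe_mk, AddHom.coe_mk, h2, Pi.zero_apply, mul_add,
      Finset.sum_add_distrib] at h1
    rw [ha, hb, inner_sum, inner_sum]
    simp only [inner_smul_right]
    linarith
  -- For k < p the summand is -s_k ⟪v_k, b⟫² ≤ 0, so the large singular values drop out; the others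
  -- satisfy s_k ≤ s₁ and 2xy ≤ x² + y².
  have hA : 2 * ⟪a, lowRank s u v b⟫_ℝ ≤ s₁ * (‖proj u a‖ ^ 2 + ‖proj v b‖ ^ 2) := by
    rw [inner_lowRank_right, proj_apply, proj_apply, norm_sum_smul_sq hu, norm_sum_smul_sq hv,
      ← Finset.sum_add_distrib, Finset.mul_sum, Finset.mul_sum]
    refine Finset.sum_le_sum fun k _ => ?_
    by_cases hk : k.val < p
    · rw [hopp k hk]
      nlinarith [mul_nonneg (hs k) (sq_nonneg ⟪v k, b⟫_ℝ), mul_nonneg hs₁ (sq_nonneg ⟪v k, b⟫_ℝ)]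
    · have := hsp k (by omega)
      nlinarith [mul_nonneg (hs k) (sq_nonneg (⟪u k, a⟫_ℝ - ⟪v k, b⟫_ℝ)),
        mul_le_mul_of_nonneg_right this (sq_nonneg ⟪u k, a⟫_ℝ),
        mul_le_mul_of_nonneg_right this (sq_nonneg ⟪v k, b⟫_ℝ)]
  have hcs : ∀ (x : W) (y : V), ⟪x, E y⟫_ℝ ≤ e * (‖x‖ * ‖y‖) := fun x y => by
    calc ⟪x, E y⟫_ℝ ≤ ‖x‖ * ‖E y‖ := real_inner_le_norm _ _
      _ ≤ ‖x‖ * (e * ‖y‖) := by gcongr; exact hE y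
      _ = _ := by ring
  have h11 := inner_proj_map_proj_le hu hv E ht hx a b
  have h11' : ⟪proj u a, E (proj v b)⟫_ℝ ≤ r * t * (‖proj u a‖ * ‖proj v b‖) := by
    refine h11.trans (le_of_eq ?_)
    have := Real.mul_self_sqrt (Nat.cast_nonneg (α := ℝ) r)
    simp only [Fintype.card_fin]
    linear_combination t * ‖proj u a‖ * ‖proj v b‖ * this
  have h12 := hcs (proj u a) (b - proj v b)
  have h21 := hcs (a - proj u a) (proj v b)
  have h22 := hcs (a - proj u a) (b - proj v b)
  have hsplit : ⟪a, E b⟫_ℝ = ⟪proj u a, E (proj v b)⟫_ℝ + ⟪proj u a, E (b - proj v b)⟫_ℝ +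
      ⟪a - proj u a, E (proj v b)⟫_ℝ + ⟪a - proj u a, E (b - proj v b)⟫_ℝ := by
    simp only [map_sub, inner_sub_left, inner_sub_right]
    ring
  have hpa := norm_proj_sq_add hu a
  have hpb := norm_proj_sq_add hv b
  rw [hM, add_apply, inner_add_right, hsplit] at hlow
  set a₁ := ‖proj u a‖
  set a₂ := ‖a - proj u a‖
  set b₁ := ‖proj v b‖
  set b₂ := ‖b - proj v b‖
  -- `hθ` is the determinant condition for the 2 × 2 form with diagonal θ - s₁ - r t, θ - e and
  -- off-diagonal e: the blocks of `E` between the span and its complement therefore enter only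
  -- through e².
  have q1 := quadratic_cross_le (x := a₁) (y := b₂) hθ (by linarith)
  have q2 := quadratic_cross_le (x := b₁) (y := a₂) hθ (by linarith)
  have hrt : 0 ≤ r * t := by positivity
  nlinarith [mul_nonneg hrt (sq_nonneg (a₁ - b₁)), mul_nonneg he (sq_nonneg (a₂ - b₂))]

end SingularValueBound

/-! ### Complementary projections and angles between subspaces -/

section Complement

variable {V W ι κ : Type*} [NormedAddCommGroup V] [InnerProductSpace ℝ V]
  [NormedAddCommGroup W] [InnerProductSpace ℝ W] [Fintype ι] [Fintype κ]

/-- The orthogonal projection onto the orthogonal complement of the span of `u`, for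
orthonormal `u`. -/
noncomputable def cproj (u : ι → W) : W →L[ℝ] W := ContinuousLinearMap.id ℝ W - proj u

theorem cproj_apply (u : ι → W) (w : W) : cproj u w = w - proj u w := rfl

theorem norm_cproj_le {u : ι → W} (hu : Orthonormal ℝ u) (w : W) : ‖cproj u w‖ ≤ ‖w‖ :=
  norm_sub_proj_le hu w

theorem proj_add_cproj (u : ι → W) (w : W) : proj u w + cproj u w = w := by
  rw [cproj_apply, add_sub_cancel]

theorem inner_cproj {u : ι → W} (hu : Orthonormal ℝ u) (w z : W) :
    ⟪z, cproj u w⟫_ℝ = ⟪cproj u z, cproj u w⟫_ℝ :=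
  inner_sub_proj_right hu w z

theorem inner_cproj_comm {u : ι → W} (hu : Orthonormal ℝ u) (w z : W) :
    ⟪cproj u z, w⟫_ℝ = ⟪z, cproj u w⟫_ℝ := by
  rw [inner_cproj hu, real_inner_comm, inner_cproj hu, real_inner_comm]

theorem norm_proj_sq_add_cproj {u : ι → W} (hu : Orthonormal ℝ u) (w : W) :
    ‖proj u w‖ ^ 2 + ‖cproj u w‖ ^ 2 = ‖w‖ ^ 2 :=
  norm_proj_sq_add hu w

theorem proj_sum_smul {u : ι → W} (hu : Orthonormal ℝ u) (c : ι → ℝ) :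
    proj u (∑ i, c i • u i) = ∑ i, c i • u i := by
  simp_rw [proj_apply, inner_sum_smul hu]

theorem cproj_sum_smul {u : ι → W} (hu : Orthonormal ℝ u) (c : ι → ℝ) :
    cproj u (∑ i, c i • u i) = 0 := by
  rw [cproj_apply, proj_sum_smul hu, sub_self]

theorem inner_proj_self {u : ι → W} (hu : Orthonormal ℝ u) (w : W) :
    ⟪proj u w, w⟫_ℝ = ‖proj u w‖ ^ 2 := by
  nth_rw 2 [← proj_add_cproj u w]
  rw [inner_add_right, real_inner_self_eq_norm_sq, inner_cproj hu, proj_apply, cproj_sum_smul hu,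
    inner_zero_left, add_zero]

theorem norm_sum_smul_le_of_norm_le (c : ι → ℝ) (x : ι → W) {b : ℝ} (hb : 0 ≤ b)
    (hx : ∀ i, ‖x i‖ ≤ b) :
    ‖∑ i, c i • x i‖ ≤ √(Fintype.card ι) * √(∑ i, c i ^ 2) * b := by
  calc ‖∑ i, c i • x i‖ ≤ ∑ i, ‖c i • x i‖ := norm_sum_le _ _
    _ ≤ ∑ i, |c i| * b := by
        refine Finset.sum_le_sum fun i _ => ?_
        rw [norm_smul, Real.norm_eq_abs]
        gcongr
        exact hx i
    _ = (∑ i, |c i|) * b := by rw [Finset.sum_mul]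
    _ ≤ _ := by
        gcongr
        rw [← Real.sqrt_mul (by positivity)]
        refine Real.le_sqrt_of_sq_le ?_
        have := sq_sum_le_card_mul_sum_sq (s := Finset.univ) (f := fun i => |c i|)
        simpa using this

/-- For orthonormal families of the same size, a bound for the sine of the largest angle between
their spans is symmetric in the two spans. -/
theorem norm_cproj_proj_le {u : ι → W} {w : κ → W} (hu : Orthonormal ℝ u) (hw : Orthonormal ℝ w)
    (hcard : Fintype.card κ ≤ Fintype.card ι) {b : ℝ} (hb : 0 ≤ b) (hb1 : b < 1)
    (h : ∀ z, ‖cproj w (proj u z)‖ ≤ b * ‖z‖) (x : W) :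
    ‖cproj u (proj w x)‖ ≤ b * ‖proj w x‖ := by
  let φ : (ι → ℝ) →ₗ[ℝ] (κ → ℝ) :=
    { toFun := fun c i => ⟪w i, ∑ k, c k • u k⟫_ℝ
      map_add' := by
        intro a b
        ext i
        simp [add_smul, Finset.sum_add_distrib, inner_add_right]
      map_smul' := by
        intro a b
        ext i
        simp [mul_smul, ← Finset.smul_sum, inner_smul_right] }
  have hproj : ∀ c, proj w (∑ k, c k • u k) = ∑ i, φ c i • w i := fun c => proj_apply _ _
  have hinj : Function.Injective φ := by
    rw [← LinearMap.ker_eq_bot, LinearMap.ker_eq_bot']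
    intro c hc
    have h1 := h (∑ k, c k • u k)
    have h2 := norm_proj_sq_add_cproj hw (∑ k, c k • u k)
    rw [hproj, hc] at h2
    rw [proj_sum_smul hu] at h1
    have h3 : ‖∑ k, c k • u k‖ = 0 := by
      simp only [Pi.zero_apply, zero_smul, Finset.sum_const_zero, norm_zero] at h2
      by_contra hne
      have hpos : 0 < ‖∑ k, c k • u k‖ := lt_of_le_of_ne (norm_nonneg _) (Ne.symm hne)
      have : ‖cproj w (∑ k, c k • u k)‖ = ‖∑ k, c k • u k‖ := by
        rw [← sq_eq_sq₀ (norm_nonneg _) (norm_nonneg _)]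
        linarith
      nlinarith
    have h4 := norm_sum_smul_sq hu c
    rw [h3] at h4
    ext i
    have h5 := (Finset.sum_eq_zero_iff_of_nonneg (fun i _ => sq_nonneg (c i))).mp
      (by rw [← h4]; norm_num) i (Finset.mem_univ i)
    simpa using h5
  -- Injectivity and `hcard` force equal dimensions, so each vector of the span of `w` is the
  -- projection of some `z` in the span of `u`.
  have hsurj : Function.Surjective φ := by
    have hle := LinearMap.finrank_le_finrank_of_injective hinj
    rw [Module.finrank_fintype_fun_eq_card, Module.finrank_fintype_fun_eq_card] at hle
    exact (LinearMap.injective_iff_surjective_of_finrank_eq_finrank (by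
      rw [Module.finrank_fintype_fun_eq_card, Module.finrank_fintype_fun_eq_card]
      omega)).mp hinj
  obtain ⟨c, hc⟩ := hsurj fun i => ⟪w i, x⟫_ℝ
  set z := ∑ k, c k • u k with hz
  have hwz : proj w z = proj w x := by
    rw [hz, hproj, hc, ← proj_apply]
  have hzu : proj u z = z := proj_sum_smul hu c
  rw [← hwz]
  have h1 := h z
  rw [hzu] at h1
  have h2 := norm_proj_sq_add_cproj hw z
  rcases eq_or_ne z 0 with h0 | h0
  · simp [h0]
  have hzpos : 0 < ‖z‖ := norm_pos_iff.mpr h0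
  set q := ‖proj w z‖ with hq
  -- lam • z is the multiple of `z` nearest to `proj w z`. It lies in the span of `u`, so its
  -- distance to `proj w z` bounds the distance to that span.
  set lam := q ^ 2 / ‖z‖ ^ 2 with hlam
  have h3 : cproj u (proj w z) = cproj u (proj w z - lam • z) := by
    have : cproj u z = 0 := cproj_sum_smul hu c
    rw [map_sub, map_smul, this, smul_zero, sub_zero]
  have h4 : ‖proj w z - lam • z‖ ^ 2 = q ^ 2 - q ^ 2 * lam := by
    rw [norm_sub_sq_real, inner_smul_right, inner_proj_self hw, norm_smul, mul_pow,
      Real.norm_eq_abs, sq_abs, ← hq, hlam]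
    field_simp
    ring
  have h5 : 1 - b ^ 2 ≤ lam := by
    rw [hlam, le_div_iff₀ (by positivity)]
    nlinarith [norm_nonneg (cproj w z)]
  rw [h3]
  refine (norm_cproj_le hu _).trans (le_of_sq_le_sq ?_ (by positivity))
  rw [h4]
  nlinarith [sq_nonneg q]

end Complement

/-! ### The action modulo leading singular spaces -/

section Truncation

variable {V W ι₁ ι₂ : Type*} [NormedAddCommGroup V] [InnerProductSpace ℝ V]
  [NormedAddCommGroup W] [InnerProductSpace ℝ W] [Fintype ι₁] [Fintype ι₂]

/-- The complementary projection kills the leading part, and the remaining part does not see the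
leading right singular vectors. -/
theorem cproj_lowRank_add_le {s₁ : ι₁ → ℝ} {u₁ : ι₁ → W} {v₁ : ι₁ → V} {s₂ : ι₂ → ℝ} {u₂ : ι₂ → W}
    {v₂ : ι₂ → V} (hu₁ : Orthonormal ℝ u₁) (hu₂ : Orthonormal ℝ u₂)
    (hv₂ : Orthonormal ℝ v₂) (hv : ∀ i j, ⟪v₂ j, v₁ i⟫_ℝ = 0)
    {θ : ℝ} (hθ : 0 ≤ θ) (hs : ∀ j, |s₂ j| ≤ θ) (z : V) :
    ‖cproj u₁ ((lowRank s₁ u₁ v₁ + lowRank s₂ u₂ v₂) z)‖ ≤ θ * ‖cproj v₁ z‖ := by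
  have h1 : cproj u₁ (lowRank s₁ u₁ v₁ z) = 0 := by
    rw [lowRank_apply, cproj_sum_smul hu₁]
  have h2 : lowRank s₂ u₂ v₂ z = lowRank s₂ u₂ v₂ (cproj v₁ z) := by
    have : lowRank s₂ u₂ v₂ (proj v₁ z) = 0 := by
      rw [lowRank_apply]
      refine Finset.sum_eq_zero fun j _ => ?_
      rw [proj_apply, inner_sum, Finset.sum_eq_zero, mul_zero, zero_smul]
      intro i _
      rw [inner_smul_right, hv, mul_zero]
    rw [cproj_apply, map_sub, this, sub_zero]
  rw [add_apply, map_add, h1, zero_add, h2]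
  exact (norm_cproj_le hu₁ _).trans (norm_lowRank_le hu₂ hv₂ hθ hs _)

end Truncation

/-! ### Approximate singular vectors of the perturbed operator -/

section Residual

variable {V W ι : Type*} [NormedAddCommGroup V] [InnerProductSpace ℝ V] [CompleteSpace V]
  [NormedAddCommGroup W] [InnerProductSpace ℝ W] [CompleteSpace W] [Fintype ι]

open ContinuousLinearMap in
/-- The correction of `u_k` that makes it a left singular vector of `A + E` up to third order terms
and the interaction inside the span of `u`. -/
noncomputable def correction (E : V →L[ℝ] W) (u : ι → W) (v : ι → V) (σ : ℝ) (k : ι) : W :=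
  σ⁻¹ • cproj u (E (v k)) + (σ ^ 2)⁻¹ • cproj u (E (cproj v (adjoint E (u k))))

open ContinuousLinearMap

theorem norm_map_cproj_adjoint_le {E : V →L[ℝ] W} {u : ι → W} {v : ι → V} (hu : Orthonormal ℝ u)
    (hv : Orthonormal ℝ v) {e : ℝ} (he : 0 ≤ e) (hE : ∀ z, ‖E z‖ ≤ e * ‖z‖)
    (hE' : ∀ w, ‖adjoint E w‖ ≤ e * ‖w‖) (k : ι) :
    ‖cproj u (E (cproj v (adjoint E (u k))))‖ ≤ e ^ 2 := by
  calc ‖cproj u (E (cproj v (adjoint E (u k))))‖ ≤ ‖E (cproj v (adjoint E (u k)))‖ :=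
        norm_cproj_le hu _
    _ ≤ e * ‖cproj v (adjoint E (u k))‖ := hE _
    _ ≤ e * (e * ‖u k‖) := by gcongr; exact (norm_cproj_le hv _).trans (hE' _)
    _ = e ^ 2 := by rw [hu.1 k]; ring

theorem norm_correction_le {E : V →L[ℝ] W} {u : ι → W} {v : ι → V} (hu : Orthonormal ℝ u)
    (hv : Orthonormal ℝ v) {e : ℝ} (he : 0 ≤ e) (hE : ∀ z, ‖E z‖ ≤ e * ‖z‖)
    (hE' : ∀ w, ‖adjoint E w‖ ≤ e * ‖w‖) {σ : ℝ} (hσ : 0 < σ) (k : ι) :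
    ‖correction E u v σ k‖ ≤ e / σ + e ^ 2 / σ ^ 2 := by
  refine (norm_add_le _ _).trans (add_le_add ?_ ?_)
  · rw [norm_smul, Real.norm_of_nonneg (by positivity), inv_mul_eq_div]
    gcongr
    calc ‖cproj u (E (v k))‖ ≤ ‖E (v k)‖ := norm_cproj_le hu _
      _ ≤ e * ‖v k‖ := hE _
      _ = e := by rw [hv.1 k, mul_one]
  · rw [norm_smul, Real.norm_of_nonneg (by positivity), inv_mul_eq_div]
    gcongr
    exact norm_map_cproj_adjoint_le hu hv he hE hE' k

/-- The corrections cancel the components outside the span of `u` through second order. Inside the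
span, only the interactions measured by t and y survive; the sign of d lets later estimates replace
s_k + d by s_k. -/
theorem residual_le {E : V →L[ℝ] W} {u : ι → W} {v : ι → V} (hu : Orthonormal ℝ u)
    (hv : Orthonormal ℝ v) {e : ℝ} (he : 0 ≤ e) (hE : ∀ z, ‖E z‖ ≤ e * ‖z‖)
    (hE' : ∀ w, ‖adjoint E w‖ ≤ e * ‖w‖) (s : ι → ℝ) (k : ι) (hs : 0 < s k) {t y : ℝ} (ht : 0 ≤ t)
    (hy : 0 ≤ y) (hx : ∀ l, |⟪u l, E (v k)⟫_ℝ| ≤ t)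
    (hxy : ∀ l, l ≠ k → |⟪u l, E (cproj v (adjoint E (u k)))⟫_ℝ| ≤ y) :
    ∃ d, 0 ≤ d ∧ ‖(lowRank s u v + E) (v k + correction (adjoint E) v u (s k) k)
        - (s k + d) • (u k + correction E u v (s k) k)‖ ≤
      √(Fintype.card ι) * (t + y / s k) + e ^ 3 / s k ^ 2 * (2 + e / s k) := by
  classical
  set σ := s k with hσ
  have hdd : ⟪u k, E (cproj v (adjoint E (u k)))⟫_ℝ = ‖cproj v (adjoint E (u k))‖ ^ 2 := by
    rw [← adjoint_inner_left, inner_cproj hv, real_inner_self_eq_norm_sq]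
  have hce : ‖cproj v (adjoint E (u k))‖ ≤ e := by
    refine (norm_cproj_le hv _).trans ((hE' _).trans ?_)
    rw [hu.1 k, mul_one]
  -- The shift of the singular value absorbs the diagonal second-order coefficient, which is a
  -- squared norm over σ and may be large. This is why y only has to bound the terms l ≠ k.
  set d := σ⁻¹ * ⟪u k, E (cproj v (adjoint E (u k)))⟫_ℝ with hd
  have hd0 : 0 ≤ d := by rw [hd, hdd]; positivity
  have hd1 : d ≤ e ^ 2 / σ := by
    rw [hd, hdd, inv_mul_eq_div]
    gcongr
  refine ⟨d, hd0, ?_⟩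
  set g := correction E u v σ k with hg
  set x₂ := E (cproj v (adjoint E (u k))) with hx₂
  set x₃ := E (cproj v (adjoint E (cproj u (E (v k))))) with hx₃
  have hh : lowRank s u v (correction (adjoint E) v u σ k) = 0 := by
    rw [correction, map_add, map_smul, map_smul]
    simp only [cproj_apply]
    rw [lowRank_sub_proj hv, lowRank_sub_proj hv]
    simp
  have hEh : E (correction (adjoint E) v u σ k) = σ⁻¹ • x₂ + (σ ^ 2)⁻¹ • x₃ := by
    rw [correction, map_add, map_smul, map_smul, adjoint_adjoint]
  have hsg : σ • g = cproj u (E (v k)) + σ⁻¹ • cproj u x₂ := by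
    rw [hg, correction, smul_add, smul_smul, smul_smul, mul_inv_cancel₀ hs.ne', one_smul]
    congr 2
    field_simp
  -- The three groups are the first-order part in the span, the off-diagonal second-order part in
  -- the span, and the terms of order three and higher.
  have key : (lowRank s u v + E) (v k + correction (adjoint E) v u σ k) - (σ + d) • (u k + g)
      = proj u (E (v k)) + (σ⁻¹ • proj u x₂ - d • u k) + ((σ ^ 2)⁻¹ • x₃ - d • g) := by
    have h1 := proj_add_cproj u (E (v k))
    have h2 := proj_add_cproj u x₂
    rw [add_apply, map_add, map_add, hh, hEh, lowRank_apply_self hv, add_smul, smul_add, hsg,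
      smul_add, ← hσ]
    nth_rw 1 [← h1, ← h2]
    rw [smul_add]
    abel
  have hcard : (0 : ℝ) ≤ √(Fintype.card ι) := by positivity
  have b1 : ‖proj u (E (v k))‖ ≤ √(Fintype.card ι) * t := by
    rw [proj_apply]
    exact norm_sum_smul_le hu ht hx
  have b2 : ‖σ⁻¹ • proj u x₂ - d • u k‖ ≤ √(Fintype.card ι) * (y / σ) := by
    have : σ⁻¹ • proj u x₂ - d • u k
        = ∑ l, (if l = k then 0 else σ⁻¹ * ⟪u l, x₂⟫_ℝ) • u l := by
      rw [proj_apply, Finset.smul_sum, ← Finset.add_sum_erase _ _ (Finset.mem_univ k),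
        ← Finset.add_sum_erase (a := k) (f := fun l => (if l = k then 0 else _) • u l) _
          (Finset.mem_univ k), smul_smul, ← hd]
      rw [if_pos rfl, zero_smul, zero_add, add_sub_cancel_left]
      refine Finset.sum_congr rfl fun l hl => ?_
      rw [if_neg (Finset.ne_of_mem_erase hl), smul_smul]
    rw [this]
    refine norm_sum_smul_le hu (by positivity) fun l => ?_
    split_ifs with hl
    · rw [abs_zero]; positivity
    · rw [abs_mul, abs_of_pos (inv_pos.mpr hs), inv_mul_eq_div]
      gcongr
      exact hxy l hl
  have b3 : ‖(σ ^ 2)⁻¹ • x₃‖ ≤ e ^ 3 / σ ^ 2 := by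
    rw [norm_smul, Real.norm_of_nonneg (by positivity), inv_mul_eq_div]
    gcongr
    calc ‖x₃‖ ≤ e * ‖cproj v (adjoint E (cproj u (E (v k))))‖ := hE _
      _ ≤ e * (e * (e * ‖v k‖)) := by
          gcongr
          refine (norm_cproj_le hv _).trans ((hE' _).trans ?_)
          gcongr
          exact (norm_cproj_le hu _).trans (hE _)
      _ = e ^ 3 := by rw [hv.1 k]; ring
  have b4 : ‖d • g‖ ≤ e ^ 2 / σ * (e / σ + e ^ 2 / σ ^ 2) := by
    rw [norm_smul, Real.norm_of_nonneg hd0]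
    gcongr
    exact norm_correction_le hu hv he hE hE' hs k
  rw [key]
  calc _ ≤ (√(Fintype.card ι) * t + √(Fintype.card ι) * (y / σ)) +
        (e ^ 3 / σ ^ 2 + e ^ 2 / σ * (e / σ + e ^ 2 / σ ^ 2)) :=
        (norm_add_le _ _).trans (add_le_add ((norm_add_le _ _).trans (add_le_add b1 b2))
          ((norm_sub_le _ _).trans (add_le_add b3 b4)))
    _ = _ := by field_simp; ring

end Residual

/-! ### Leading and trailing parts, and comparison of truncations -/

section HeadTail

variable {V W : Type*} [NormedAddCommGroup V] [InnerProductSpace ℝ V]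
  [NormedAddCommGroup W] [InnerProductSpace ℝ W]

/-- The part of a family indexed by `Fin r` with index below `p`. -/
def head {r : ℕ} {α : Type*} (p : ℕ) (f : Fin r → α) (i : {i : Fin r // i.val < p}) : α := f i

/-- The part of a family indexed by `Fin r` with index at least `p`. -/
def tail {r : ℕ} {α : Type*} (p : ℕ) (f : Fin r → α) (i : {i : Fin r // ¬ i.val < p}) : α := f i

theorem orthonormal_head {r : ℕ} {u : Fin r → W} (hu : Orthonormal ℝ u) (p : ℕ) :
    Orthonormal ℝ (head p u) :=
  hu.comp _ Subtype.val_injective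

theorem orthonormal_tail {r : ℕ} {u : Fin r → W} (hu : Orthonormal ℝ u) (p : ℕ) :
    Orthonormal ℝ (tail p u) :=
  hu.comp _ Subtype.val_injective

theorem inner_tail_head {r : ℕ} {u : Fin r → W} (hu : Orthonormal ℝ u) (p : ℕ)
    (i : {i : Fin r // i.val < p}) (j : {i : Fin r // ¬ i.val < p}) :
    ⟪tail p u j, head p u i⟫_ℝ = 0 :=
  hu.2 fun h => j.2 (by rw [h]; exact i.2)

theorem lowRank_head_add_tail {r : ℕ} (p : ℕ) (s : Fin r → ℝ) (u : Fin r → W) (v : Fin r → V) :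
    lowRank (head p s) (head p u) (head p v) + lowRank (tail p s) (tail p u) (tail p v)
      = lowRank s u v := by
  ext z
  rw [add_apply, lowRank_apply, lowRank_apply, lowRank_apply]
  exact Fintype.sum_subtype_add_sum_subtype (fun i : Fin r => i.val < p)
    (fun i => (s i * ⟪v i, z⟫_ℝ) • u i)

theorem card_head_le (r p : ℕ) : Fintype.card {i : Fin r // i.val < p} ≤ p := by
  simpa using Fintype.card_le_of_injective (β := Fin p)
    (fun i : {i : Fin r // i.val < p} => ⟨i.1.1, i.2⟩)
    (fun a b h => Subtype.ext (Fin.ext (by simpa using h)))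

theorem le_card_head {r p : ℕ} (h : p ≤ r) : p ≤ Fintype.card {i : Fin r // i.val < p} := by
  simpa using Fintype.card_le_of_injective (α := Fin p)
    (fun i : Fin p => (⟨Fin.castLE h i, i.2⟩ : {i : Fin r // i.val < p}))
    (fun a b hab => by simpa [Fin.ext_iff] using hab)

theorem mul_norm_cproj_le {ι₁ : Type*} [Fintype ι₁] {f : ι₁ → W} (hf : Orthonormal ℝ f) {m x : W}
    {q R b : ℝ} (hq : 0 ≤ q) (h : ‖m - q • x‖ ≤ R) (hm : ‖cproj f m‖ ≤ b) :
    q * ‖cproj f x‖ ≤ b + R := by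
  have : q • cproj f x = cproj f m - cproj f (m - q • x) := by
    rw [map_sub, map_smul]; abel
  rw [← abs_of_nonneg hq, ← Real.norm_eq_abs, ← norm_smul, this]
  exact (norm_sub_le _ _).trans (add_le_add hm ((norm_cproj_le hf _).trans h))

/-- Eliminating X gives (s - θ) Z ≤ R, and s/(s - θ) decreases in s, so its value at σ is the worst.
Here X and Z are the parts of the corrected right and left vectors outside the leading spaces of the
perturbed operator. -/
theorem coupled_bound {a a' s σ θ R X Z : ℝ} (hX : 0 ≤ X) (hZ : 0 ≤ Z) (hθ : 0 ≤ θ)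
    (hθσ : θ < σ) (hσs : σ ≤ s) (ha : s ≤ a) (ha' : s ≤ a') (h : a * Z ≤ θ * X + R)
    (h' : a' * X ≤ θ * Z + R) : s * Z ≤ σ * R / (σ - θ) := by
  have h1 : s * Z ≤ θ * X + R := (mul_le_mul_of_nonneg_right ha hZ).trans h
  have h2 : s * X ≤ θ * Z + R := (mul_le_mul_of_nonneg_right ha' hX).trans h'
  have hsp : 0 < s := by linarith
  have h3 : (s - θ) * Z ≤ R := by
    have : (s + θ) * ((s - θ) * Z) ≤ (s + θ) * R := by
      nlinarith [mul_le_mul_of_nonneg_left h1 hsp.le, mul_le_mul_of_nonneg_left h2 hθ]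
    exact le_of_mul_le_mul_left this (by linarith)
  rw [le_div_iff₀ (by linarith)]
  have h4 : (σ - θ) * (s * Z) ≤ σ * ((s - θ) * Z) := by nlinarith [mul_nonneg hθ hZ]
  nlinarith [mul_le_mul_of_nonneg_left h3 (by linarith : (0 : ℝ) ≤ σ)]

/-- If the truncations of `A` and `A + E` have almost the same range and corange, then they are
close to each other. -/
theorem norm_truncation_sub_le {r r' p : ℕ} (hpr : p ≤ r) {s : Fin r → ℝ} {u : Fin r → W}
    {v : Fin r → V} (hu : Orthonormal ℝ u) (hv : Orthonormal ℝ v) {s' : Fin r' → ℝ}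
    {u' : Fin r' → W} {v' : Fin r' → V} (hu' : Orthonormal ℝ u') (hv' : Orthonormal ℝ v')
    {E : V →L[ℝ] W} (hM : lowRank s' u' v' = lowRank s u v + E) {σ e B : ℝ} (hσ : 0 < σ)
    (hE : ∀ z, ‖E z‖ ≤ e * ‖z‖) (hB : 0 ≤ B) (hs : ∀ i, 0 ≤ s i)
    (hsσ : ∀ i : Fin r, i.val < p → σ ≤ s i) (hsσ' : ∀ i : Fin r, ¬ i.val < p → s i ≤ σ)
    (hs' : ∀ i : Fin r', ¬ i.val < p → |s' i| ≤ σ)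
    (hL : ∀ z, ‖cproj (head p u') (lowRank (head p s) (head p u) (head p v) z)‖ ≤ B * ‖z‖)
    (hR : ∀ w, ‖cproj (head p v') (lowRank (head p s) (head p v) (head p u) w)‖ ≤ B * ‖w‖) (z : V) :
    ‖lowRank (head p s') (head p u') (head p v') z - lowRank (head p s) (head p u) (head p v) z‖ ≤
      (3 * B + e) * ‖z‖ := by
  have hsplit := lowRank_head_add_tail p s u v
  have hsplit' := lowRank_head_add_tail p s' u' v'
  set A₁ := lowRank (head p s) (head p u) (head p v) with hA₁
  set A₂ := lowRank (tail p s) (tail p u) (tail p v) with hA₂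
  set M₁ := lowRank (head p s') (head p u') (head p v') with hM₁
  set M₂ := lowRank (tail p s') (tail p u') (tail p v') with hM₂
  have hMz : ∀ z, M₁ z + M₂ z = A₁ z + A₂ z + E z := fun z => by
    rw [← add_apply, ← add_apply, ← add_apply, hsplit, hsplit', hM]
  have hA₂n : ∀ z, ‖A₂ z‖ ≤ σ * ‖z‖ :=
    norm_lowRank_le (orthonormal_tail hu p) (orthonormal_tail hv p) hσ.le fun i => by
      rw [tail, abs_of_nonneg (hs _)]
      exact hsσ' i i.2
  have hM₂n : ∀ z, ‖M₂ z‖ ≤ σ * ‖z‖ :=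
    norm_lowRank_le (orthonormal_tail hu' p) (orthonormal_tail hv' p) hσ.le fun i => hs' i i.2
  -- If σ ≤ B, the two tails have norm at most σ and the claim is immediate. Otherwise B/σ < 1, as
  -- the symmetry of angles requires.
  by_cases hBσ : σ ≤ B
  · have h1 : M₁ z - A₁ z = A₂ z + E z - M₂ z := by
      rw [sub_eq_sub_iff_add_eq_add, hMz]
      abel
    rw [h1]
    calc _ ≤ σ * ‖z‖ + e * ‖z‖ + σ * ‖z‖ :=
          (norm_sub_le _ _).trans (add_le_add ((norm_add_le _ _).trans
            (add_le_add (hA₂n z) (hE z))) (hM₂n z))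
      _ ≤ _ := by nlinarith [norm_nonneg z]
  push Not at hBσ
  have hou' := orthonormal_head hu' p
  have hov' := orthonormal_head hv' p
  have hov := orthonormal_head hv p
  have hou := orthonormal_head hu p
  have hsin : ∀ x, ‖cproj (head p v) (proj (head p v') x)‖ ≤ B / σ * ‖proj (head p v') x‖ := by
    refine norm_cproj_proj_le hov hov' ((card_head_le r' p).trans (le_card_head hpr))
      (by positivity) ((div_lt_one hσ).mpr hBσ) fun x => ?_
    -- The projection factors through the adjoint of A₁ and an inverse on its range of norm at most
    -- 1/σ, so `hR` bounds the sine of the angle by B/σ.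
    have h1 : proj (head p v) x = lowRank (head p s) (head p v) (head p u)
        (lowRank (fun i => (head p s i)⁻¹) (head p u) (head p v) x) := by
      rw [lowRank_lowRank hou, proj]
      congr 2
      ext i
      exact (mul_inv_cancel₀ (hσ.trans_le (hsσ i i.2)).ne').symm
    rw [h1]
    refine (hR _).trans ?_
    have h2 : ‖lowRank (fun i => (head p s i)⁻¹) (head p u) (head p v) x‖ ≤ σ⁻¹ * ‖x‖ :=
      norm_lowRank_le hou hov (by positivity) (fun i => by
        have : σ ≤ head p s i := hsσ i i.2
        rw [abs_of_pos (inv_pos.mpr (hσ.trans_le this))]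
        gcongr) x
    calc _ ≤ B * (σ⁻¹ * ‖x‖) := by gcongr
      _ = _ := by rw [div_eq_mul_inv]; ring
  have hM₁p : M₁ z = proj (head p u') (A₁ (proj (head p v') z) + A₂ (proj (head p v') z)
      + E (proj (head p v') z)) := by
    have h1 : M₂ (proj (head p v') z) = 0 := by
      rw [hM₂, lowRank_apply]
      refine Finset.sum_eq_zero fun j _ => ?_
      rw [proj_apply, inner_sum, Finset.sum_eq_zero, mul_zero, zero_smul]
      intro i _
      rw [inner_smul_right, inner_tail_head hv', mul_zero]
    have h2 : M₁ (proj (head p v') z) = M₁ z := by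
      have h := lowRank_sub_proj hov' (head p s') (head p u') z
      rw [map_sub, sub_eq_zero] at h
      exact h.symm
    rw [← hMz, h1, add_zero, h2, hM₁, lowRank_apply, proj_sum_smul hou']
  have hA₁c : ‖A₁ (cproj (head p v') z)‖ ≤ B * ‖z‖ := by
    set w := A₁ (cproj (head p v') z) with hw
    -- Duality: A₁ after the complementary projection is the adjoint of the operator in `hR`.
    have h1 : ‖w‖ ^ 2 ≤ B * ‖w‖ * ‖z‖ := by
      calc ‖w‖ ^ 2 = ⟪w, A₁ (cproj (head p v') z)⟫_ℝ := by
            rw [← hw, real_inner_self_eq_norm_sq]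
        _ = ⟪cproj (head p v') (lowRank (head p s) (head p v) (head p u) w), z⟫_ℝ := by
            rw [hA₁, ← inner_lowRank_comm, inner_cproj_comm hov']
        _ ≤ _ := (real_inner_le_norm _ _).trans (by gcongr; exact hR w)
    rcases (norm_nonneg w).eq_or_lt with h0 | h0
    · rw [← h0]; positivity
    · exact le_of_mul_le_mul_left (by linarith) h0
  have hA₂p : ‖A₂ (proj (head p v') z)‖ ≤ B * ‖z‖ := by
    have h1 : A₂ (proj (head p v') z) = A₂ (cproj (head p v) (proj (head p v') z)) := by
      have : A₂ (proj (head p v) (proj (head p v') z)) = 0 := by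
        rw [hA₂, lowRank_apply]
        refine Finset.sum_eq_zero fun j _ => ?_
        rw [proj_apply, inner_sum, Finset.sum_eq_zero, mul_zero, zero_smul]
        intro i _
        rw [inner_smul_right, inner_tail_head hv, mul_zero]
      rw [cproj_apply (head p v), map_sub, this, sub_zero]
    rw [h1]
    calc _ ≤ σ * ‖cproj (head p v) (proj (head p v') z)‖ := hA₂n _
      _ ≤ σ * (B / σ * ‖z‖) := by
          gcongr
          refine (hsin z).trans ?_
          gcongr
          exact norm_proj_le hov' z
      _ = _ := by field_simp
  have hEp : ‖E (proj (head p v') z)‖ ≤ e * ‖z‖ := by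
    rcases eq_or_ne z 0 with h0 | h0
    · simp [h0]
    · have he : 0 ≤ e := nonneg_of_mul_nonneg_left ((norm_nonneg _).trans (hE z))
        (norm_pos_iff.mpr h0)
      refine (hE _).trans ?_
      gcongr
      exact norm_proj_le hov' z
  -- Since M₁ is A + E compressed to its leading spaces, the difference has four pieces, of sizes B,
  -- e, B and B times ‖z‖.
  have hfin : M₁ z - A₁ z = proj (head p u') (A₂ (proj (head p v') z) + E (proj (head p v') z)
      - A₁ (cproj (head p v') z)) - cproj (head p u') (A₁ z) := by
    have h1 : A₁ z = A₁ (proj (head p v') z) + A₁ (cproj (head p v') z) := by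
      rw [← map_add, proj_add_cproj]
    rw [hM₁p, cproj_apply (head p u') (A₁ z)]
    nth_rw 3 [h1]
    simp only [map_add, map_sub]
    abel
  rw [hfin]
  calc _ ≤ B * ‖z‖ + e * ‖z‖ + B * ‖z‖ + B * ‖z‖ :=
        (norm_sub_le _ _).trans (add_le_add ((norm_proj_le hou' _).trans
          ((norm_sub_le _ _).trans (add_le_add ((norm_add_le _ _).trans (add_le_add hA₂p hEp))
            hA₁c))) (hL z))
    _ = _ := by ring

end HeadTail

/-! ### The deterministic perturbation bound -/

section Deterministic

variable {V W : Type*} [NormedAddCommGroup V] [InnerProductSpace ℝ V] [CompleteSpace V]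
  [NormedAddCommGroup W] [InnerProductSpace ℝ W] [CompleteSpace W]

open ContinuousLinearMap

/-- Returns from corrected vectors to the u_k. The factors s_k cancel the σ⁻¹ in the first-order
corrections, which therefore sum to `E` applied to one vector and cost e rather than √p e. -/
theorem norm_cproj_lowRank_head_le {r p : ℕ} {ι₁ : Type*} [Fintype ι₁] {E : V →L[ℝ] W}
    {u : Fin r → W} {v : Fin r → V} (hu : Orthonormal ℝ u) (hv : Orthonormal ℝ v) {e : ℝ}
    (he : 0 ≤ e) (hE : ∀ z, ‖E z‖ ≤ e * ‖z‖) (hE' : ∀ w, ‖adjoint E w‖ ≤ e * ‖w‖) {s : Fin r → ℝ}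
    {σ : ℝ} (hσ : 0 < σ) (hs : ∀ i : Fin r, i.val < p → σ ≤ s i) {u₁ : ι₁ → W}
    (hu₁ : Orthonormal ℝ u₁) {β : ℝ} (hβ : 0 ≤ β)
    (hZ : ∀ i : Fin r, i.val < p → s i * ‖cproj u₁ (u i + correction E u v (s i) i)‖ ≤ β) (z : V) :
    ‖cproj u₁ (lowRank (head p s) (head p u) (head p v) z)‖ ≤
      (√p * β + e + √p * (e ^ 2 / σ)) * ‖z‖ := by
  set c : {i : Fin r // i.val < p} → ℝ := fun k => ⟪v k, z⟫_ℝ with hc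
  have hcn : √(∑ k, c k ^ 2) ≤ ‖z‖ :=
    Real.sqrt_le_iff.mpr ⟨norm_nonneg _, sum_inner_sq_le (orthonormal_head hv p) z⟩
  have hpos : ∀ k : {i : Fin r // i.val < p}, 0 < s k := fun k => hσ.trans_le (hs k k.2)
  have hsum : ∀ x : {i : Fin r // i.val < p} → W, ∀ b, 0 ≤ b → (∀ k, ‖x k‖ ≤ b) →
      ‖∑ k, c k • x k‖ ≤ √p * b * ‖z‖ := by
    intro x b hb hx
    calc ‖∑ k, c k • x k‖
        ≤ √(Fintype.card {i : Fin r // i.val < p}) * √(∑ k, c k ^ 2) * b :=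
          norm_sum_smul_le_of_norm_le c x hb hx
      _ ≤ √p * ‖z‖ * b := by
          gcongr
          exact_mod_cast card_head_le r p
      _ = _ := by ring
  have hdecomp : lowRank (head p s) (head p u) (head p v) z
      = (∑ k : {i : Fin r // i.val < p}, c k • s k • (u k + correction E u v (s k) k))
        - cproj u (E (∑ k, c k • head p v k))
        - ∑ k : {i : Fin r // i.val < p},
            c k • (s k)⁻¹ • cproj u (E (cproj v (adjoint E (u k)))) := by
    rw [lowRank_apply, map_sum, map_sum, ← Finset.sum_sub_distrib, ← Finset.sum_sub_distrib]
    refine Finset.sum_congr rfl fun k _ => ?_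
    have hne := (hpos k).ne'
    have h1 : s k * (s k ^ 2)⁻¹ = (s k)⁻¹ := by field_simp
    rw [correction, smul_add, smul_add, smul_add, smul_add, smul_smul (s k) (s k)⁻¹,
      mul_inv_cancel₀ hne, one_smul, smul_smul (s k) (s k ^ 2)⁻¹, h1, map_smul, map_smul]
    simp only [head, hc]
    rw [mul_comm, mul_smul]
    abel
  have t1 : ‖cproj u₁ (∑ k : {i : Fin r // i.val < p},
      c k • s k • (u k + correction E u v (s k) k))‖ ≤ √p * β * ‖z‖ := by
    rw [map_sum]
    simp_rw [map_smul]
    refine hsum _ β hβ fun k => ?_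
    rw [norm_smul, Real.norm_of_nonneg (hpos k).le]
    exact hZ k k.2
  have t2 : ‖cproj u (E (∑ k, c k • head p v k))‖ ≤ e * ‖z‖ := by
    refine (norm_cproj_le hu _).trans ((hE _).trans ?_)
    gcongr
    have : ∑ k, c k • head p v k = proj (head p v) z := by rw [proj_apply]; rfl
    rw [this]
    exact norm_proj_le (orthonormal_head hv p) z
  have t3 : ‖∑ k : {i : Fin r // i.val < p},
      c k • (s k)⁻¹ • cproj u (E (cproj v (adjoint E (u k))))‖ ≤ √p * (e ^ 2 / σ) * ‖z‖ := by
    refine hsum _ _ (by positivity) fun k => ?_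
    rw [norm_smul, Real.norm_of_nonneg (inv_nonneg.mpr (hpos k).le), inv_mul_eq_div]
    exact div_le_div₀ (by positivity) (norm_map_cproj_adjoint_le hu hv he hE hE' k) hσ (hs k k.2)
  rw [hdecomp, map_sub, map_sub]
  calc _ ≤ √p * β * ‖z‖ + e * ‖z‖ + √p * (e ^ 2 / σ) * ‖z‖ :=
        (norm_sub_le _ _).trans (add_le_add ((norm_sub_le _ _).trans
          (add_le_add t1 ((norm_cproj_le hu₁ _).trans t2))) ((norm_cproj_le hu₁ _).trans t3))
    _ = _ := by ring

/-- The projected second-order coefficient is a Gram entry minus a sum of r products of bilinear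
entries. -/
theorem abs_inner_map_cproj_adjoint_le {r : ℕ} {E : V →L[ℝ] W} {u : Fin r → W} {v : Fin r → V}
    {t y : ℝ} (hx : ∀ l k, |⟪u l, E (v k)⟫_ℝ| ≤ t) {l k : Fin r}
    (hy : |⟪adjoint E (u l), adjoint E (u k)⟫_ℝ| ≤ y) :
    |⟪u l, E (cproj v (adjoint E (u k)))⟫_ℝ| ≤ y + r * t ^ 2 := by
  have h1 : ⟪u l, E (cproj v (adjoint E (u k)))⟫_ℝ = ⟪adjoint E (u l), adjoint E (u k)⟫_ℝ
      - ∑ j, ⟪u k, E (v j)⟫_ℝ * ⟪u l, E (v j)⟫_ℝ := by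
    rw [cproj_apply, map_sub, inner_sub_right, adjoint_inner_left, proj_apply, map_sum, inner_sum]
    congr 1
    refine Finset.sum_congr rfl fun j _ => ?_
    rw [map_smul, inner_smul_right, adjoint_inner_right, real_inner_comm]
  rw [h1]
  refine (abs_sub _ _).trans (add_le_add hy ((Finset.abs_sum_le_sum_abs _ _).trans ?_))
  calc ∑ j, |⟪u k, E (v j)⟫_ℝ * ⟪u l, E (v j)⟫_ℝ| ≤ ∑ _j : Fin r, t ^ 2 := by
        refine Finset.sum_le_sum fun j _ => ?_
        rw [abs_mul, pow_two]
        exact mul_le_mul (hx k j) (hx l j) (abs_nonneg _) ((abs_nonneg _).trans (hx k j))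
    _ = _ := by simp

/-- Neither residual equation closes alone, because `hL` brings in the right vector and `hR` the
left one; `coupled_bound` solves the pair for each k. -/
theorem singular_subspace_bound {r p : ℕ} {ι₁ : Type*} [Fintype ι₁] {s : Fin r → ℝ}
    {u : Fin r → W} {v : Fin r → V} (hu : Orthonormal ℝ u) (hv : Orthonormal ℝ v)
    {u₁ : ι₁ → W} {v₁ : ι₁ → V} (hu₁ : Orthonormal ℝ u₁) (hv₁ : Orthonormal ℝ v₁)
    {E : V →L[ℝ] W} {e t y σ θ : ℝ} (he : 0 ≤ e) (hE : ∀ z, ‖E z‖ ≤ e * ‖z‖)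
    (hE' : ∀ w, ‖adjoint E w‖ ≤ e * ‖w‖) (ht : 0 ≤ t) (hy : 0 ≤ y) (hθ : 0 ≤ θ) (hθσ : θ < σ)
    (hsσ : ∀ i : Fin r, i.val < p → σ ≤ s i) (hx : ∀ l k, |⟪u l, E (v k)⟫_ℝ| ≤ t)
    (hyu : ∀ l k, l ≠ k → |⟪adjoint E (u l), adjoint E (u k)⟫_ℝ| ≤ y)
    (hyv : ∀ l k, l ≠ k → |⟪E (v l), E (v k)⟫_ℝ| ≤ y)
    (hL : ∀ z, ‖cproj u₁ ((lowRank s u v + E) z)‖ ≤ θ * ‖cproj v₁ z‖)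
    (hR : ∀ w, ‖cproj v₁ ((lowRank s v u + adjoint E) w)‖ ≤ θ * ‖cproj u₁ w‖) (z : V) :
    ‖cproj u₁ (lowRank (head p s) (head p u) (head p v) z)‖ ≤
      (√p * (σ * (√r * (t + (y + r * t ^ 2) / σ) + e ^ 3 / σ ^ 2 * (2 + e / σ)) / (σ - θ)) + e
        + √p * (e ^ 2 / σ)) * ‖z‖ := by
  have hσ : 0 < σ := hθ.trans_lt hθσ
  set y' := y + r * t ^ 2 with hy'
  have hy'0 : 0 ≤ y' := by positivity
  set R := √r * (t + y' / σ) + e ^ 3 / σ ^ 2 * (2 + e / σ) with hRdef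
  have hR0 : 0 ≤ R := by positivity
  have hβ : 0 ≤ σ * R / (σ - θ) := div_nonneg (by positivity) (by linarith)
  refine norm_cproj_lowRank_head_le hu hv he hE hE' hσ hsσ hu₁ hβ (fun k hk => ?_) z
  have hsk : 0 < s k := hσ.trans_le (hsσ k hk)
  have hmono : √(Fintype.card (Fin r)) * (t + y' / s k) + e ^ 3 / s k ^ 2 * (2 + e / s k) ≤ R := by
    rw [Fintype.card_fin, hRdef]
    have := hsσ k hk
    gcongr
  have hx' : ∀ l k, |⟪v l, adjoint E (u k)⟫_ℝ| ≤ t := fun l k => by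
    rw [adjoint_inner_right, real_inner_comm]
    exact hx k l
  obtain ⟨d, hd, hρ⟩ := residual_le hu hv he hE hE' s k hsk ht hy'0 (fun l => hx l k)
    (fun l hl => abs_inner_map_cproj_adjoint_le hx (hyu l k hl))
  obtain ⟨d', hd', hρ'⟩ := residual_le (E := adjoint E) hv hu he hE'
    (by rw [adjoint_adjoint]; exact hE) s k hsk ht hy'0 (fun l => hx' l k)
    (fun l hl => abs_inner_map_cproj_adjoint_le hx' (by rw [adjoint_adjoint]; exact hyv l k hl))
  rw [adjoint_adjoint] at hρ'
  exact coupled_bound (norm_nonneg _) (norm_nonneg _) hθ hθσ (hsσ k hk)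
    (le_add_of_nonneg_right hd) (le_add_of_nonneg_right hd')
    (mul_norm_cproj_le hu₁ (by positivity) (hρ.trans hmono) (hL _))
    (mul_norm_cproj_le hv₁ (by positivity) (hρ'.trans hmono) (hR _))

/-- A perturbation bound for the truncation of `∑ s_i u_i v_iᵀ`, in terms of the interaction of the
perturbation `E` with the singular vectors. -/
theorem norm_truncation_sub_le_of_interaction {r r' p : ℕ} (hp : 1 ≤ p) (hpr : p ≤ r)
    {s : Fin r → ℝ} {u : Fin r → W} {v : Fin r → V} (hu : Orthonormal ℝ u) (hv : Orthonormal ℝ v)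
    {s' : Fin r' → ℝ} {u' : Fin r' → W} {v' : Fin r' → V} (hu' : Orthonormal ℝ u')
    (hv' : Orthonormal ℝ v') (hs'a : Antitone s') (hs'0 : ∀ i, 0 ≤ s' i)
    {E : V →L[ℝ] W} (hM : lowRank s' u' v' = lowRank s u v + E) {e t y σ σ₁ : ℝ}
    (he : 0 ≤ e) (hE : ∀ z, ‖E z‖ ≤ e * ‖z‖) (hE' : ∀ w, ‖adjoint E w‖ ≤ e * ‖w‖)
    (ht : 0 ≤ t) (hy : 0 ≤ y) (hs : ∀ i, 0 ≤ s i) (hσ₁ : 0 ≤ σ₁) (hσ : σ₁ < σ)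
    (hsσ : ∀ i : Fin r, i.val < p → σ ≤ s i) (hsσ₁ : ∀ i : Fin r, ¬ i.val < p → s i ≤ σ₁)
    (hx : ∀ l k, |⟪u l, E (v k)⟫_ℝ| ≤ t)
    (hyu : ∀ l k, l ≠ k → |⟪adjoint E (u l), adjoint E (u k)⟫_ℝ| ≤ y)
    (hyv : ∀ l k, l ≠ k → |⟪E (v l), E (v k)⟫_ℝ| ≤ y)
    (hc₁ : p * e ≤ σ / 96) (hc₂ : (r : ℝ) ^ 2 * t ≤ (σ - σ₁) / 48)
    (hc₃ : r * e ^ 2 ≤ σ * (σ - σ₁) / 96 ^ 2) (z : V) :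
    ‖lowRank (head p s') (head p u') (head p v') z - lowRank (head p s) (head p u) (head p v) z‖ ≤
      (49 / 8 * (r * t * σ / (σ - σ₁)) + 6 * (r * y / (σ - σ₁)) + 5 * e) * ‖z‖ := by
  obtain ⟨δ, rfl⟩ : ∃ δ, σ₁ = σ - δ := ⟨σ - σ₁, by ring⟩
  rw [sub_sub_cancel] at *
  have hδ : 0 < δ := by linarith
  have hδσ : δ ≤ σ := by linarith
  have hσ0 : 0 < σ := by linarith
  have hp1 : (1 : ℝ) ≤ p := by exact_mod_cast hp
  have hpr' : (p : ℝ) ≤ r := by exact_mod_cast hpr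
  have hr1 : (1 : ℝ) ≤ r := hp1.trans hpr'
  have heσ : e ≤ σ / 96 := by nlinarith
  have hrt : r * t ≤ δ / 48 := by nlinarith [mul_nonneg (by linarith : (0 : ℝ) ≤ r) ht]
  have hee : e ^ 2 ≤ σ * δ / 96 ^ 2 := by nlinarith [sq_nonneg e]
  -- The midpoint of the gap; r t ≤ δ/48 and e² ≤ σδ/96² leave ample room in the determinant
  -- condition.
  set θ := σ - δ / 2 with hθ
  have hsv : ∀ j : Fin r', p ≤ j.val → s' j ≤ θ :=
    singularValue_le hpr hu hv hu' hv' hs'a hs hσ₁ (fun i hi => hsσ₁ i (by omega)) hM ht hE he hx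
      (by linarith) (by
        have h1 : 23 / 48 * δ ≤ θ - (σ - δ) - r * t := by linarith
        have h2 : 47 / 96 * σ ≤ θ - e := by linarith
        have h3 : 23 / 48 * δ * (47 / 96 * σ) ≤ (θ - (σ - δ) - r * t) * (θ - e) :=
          mul_le_mul h1 h2 (by positivity) ((by positivity : (0 : ℝ) ≤ 23 / 48 * δ).trans h1)
        nlinarith [mul_pos hσ0 hδ])
  have hθ0 : 0 ≤ θ := by linarith
  have hθσ : θ < σ := by linarith
  have htail : ∀ i : {i : Fin r' // ¬ i.val < p}, |tail p s' i| ≤ θ := fun i => by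
    rw [tail, abs_of_nonneg (hs'0 _)]
    exact hsv i (by have := i.2; omega)
  have hL : ∀ z, ‖cproj (head p u') ((lowRank s u v + E) z)‖ ≤ θ * ‖cproj (head p v') z‖ := by
    intro z
    rw [← hM, ← lowRank_head_add_tail p s' u' v']
    exact cproj_lowRank_add_le (orthonormal_head hu' p) (orthonormal_tail hu' p)
      (orthonormal_tail hv' p) (fun i j => inner_tail_head hv' p i j) hθ0 htail z
  have hMadj : lowRank s' v' u' = lowRank s v u + adjoint E := by
    rw [← adjoint_lowRank s' u' v', hM, map_add, adjoint_lowRank]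
  have hR : ∀ w, ‖cproj (head p v') ((lowRank s v u + adjoint E) w)‖ ≤
      θ * ‖cproj (head p u') w‖ := by
    intro w
    rw [← hMadj, ← lowRank_head_add_tail p s' v' u']
    exact cproj_lowRank_add_le (orthonormal_head hv' p) (orthonormal_tail hv' p)
      (orthonormal_tail hu' p) (fun i j => inner_tail_head hu' p i j) hθ0 htail w
  have bL := singular_subspace_bound hu hv (orthonormal_head hu' p) (orthonormal_head hv' p) he hE
    hE' ht hy hθ0 hθσ hsσ hx hyu hyv hL hR
  have bR := singular_subspace_bound (E := adjoint E) hv hu (orthonormal_head hv' p)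
    (orthonormal_head hu' p) he hE' (by rw [adjoint_adjoint]; exact hE) ht hy hθ0 hθσ hsσ
    (fun l k => by
      rw [adjoint_inner_right, real_inner_comm]
      exact hx k l) (by rw [adjoint_adjoint]; exact hyv) hyu hR (by rw [adjoint_adjoint]; exact hL)
  set B := √p * (σ * (√r * (t + (y + r * t ^ 2) / σ) + e ^ 3 / σ ^ 2 * (2 + e / σ)) / (σ - θ)) + e
        + √p * (e ^ 2 / σ) with hB
  have hB0 : 0 ≤ B := by
    have : 0 ≤ σ - θ := by linarith
    positivity
  refine (norm_truncation_sub_le hpr hu hv hu' hv' hM hσ0 hE hB0 hs hsσ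
    (fun i hi => (hsσ₁ i hi).trans (by linarith)) (fun i hi => (htail ⟨i, hi⟩).trans hθσ.le) bL bR
    z).trans ?_
  refine mul_le_mul_of_nonneg_right ?_ (norm_nonneg z)
  have hsp : √(p : ℝ) ≤ p := by
    rw [Real.sqrt_le_left (by linarith)]
    nlinarith
  have hspr : √(p : ℝ) * √r ≤ r := by
    calc √(p : ℝ) * √r ≤ √r * √r := by gcongr
      _ = r := Real.mul_self_sqrt (by linarith)
  have hθd : σ - θ = δ / 2 := by rw [hθ]; ring
  have e1 : √(p : ℝ) * (e ^ 2 / σ) ≤ e / 96 := by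
    calc √(p : ℝ) * (e ^ 2 / σ) ≤ p * (e ^ 2 / σ) := by gcongr
      _ = (p * e) * e / σ := by ring
      _ ≤ (σ / 96) * e / σ := by gcongr
      _ = e / 96 := by field_simp
  have e2 : √(p : ℝ) * (σ * (e ^ 3 / σ ^ 2 * (2 + e / σ)) / (σ - θ)) ≤ e / 100 := by
    have h1 : e / σ ≤ 1 := by rw [div_le_one hσ0]; linarith
    calc √(p : ℝ) * (σ * (e ^ 3 / σ ^ 2 * (2 + e / σ)) / (σ - θ))
        ≤ r * (σ * (e ^ 3 / σ ^ 2 * (2 + 1)) / (δ / 2)) := by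
          rw [hθd]
          gcongr
          exact hsp.trans hpr'
      _ = 6 * e * (r * e ^ 2) / (σ * δ) := by field_simp; ring
      _ ≤ 6 * e * (σ * δ / 96 ^ 2) / (σ * δ) := by gcongr
      _ = 6 * e / 96 ^ 2 := by field_simp
      _ ≤ e / 100 := by linarith
  -- Here 49/24 = 2 (1 + 1/48): the 2 comes from σ - θ = δ/2, the 1/48 from absorbing r t²/σ into t.
  have e3 : √(p : ℝ) * (σ * (√r * (t + (y + r * t ^ 2) / σ)) / (σ - θ)) ≤
      49 / 24 * (r * t * σ / δ) + 2 * (r * y / δ) := by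
    have h1 : r * t ^ 2 / σ ≤ t / 48 := by
      rw [div_le_iff₀ hσ0]
      nlinarith
    calc √(p : ℝ) * (σ * (√r * (t + (y + r * t ^ 2) / σ)) / (σ - θ))
        = (√p * √r) * (σ * (t + y / σ + r * t ^ 2 / σ) / (δ / 2)) := by rw [hθd]; ring
      _ ≤ r * (σ * (t + y / σ + t / 48) / (δ / 2)) := by gcongr
      _ = _ := by field_simp; ring
  -- Then 3B + e gives 49/8, 6, and a coefficient of e below 5.
  have hBle : B ≤ (49 / 24 * (r * t * σ / δ) + 2 * (r * y / δ)) + e / 100 + e + e / 96 := by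
    have h1 : B = √p * (σ * (√r * (t + (y + r * t ^ 2) / σ)) / (σ - θ))
        + √p * (σ * (e ^ 3 / σ ^ 2 * (2 + e / σ)) / (σ - θ)) + e + √p * (e ^ 2 / σ) := by
      rw [hB]; ring
    rw [h1]
    linarith
  linarith

end Deterministic

/-! ### Bernstein tails and second moments for bounded independent variables -/

section Concentration

variable {Ω α : Type*} [MeasurableSpace Ω]

/-- A measurable real function that is bounded almost everywhere. -/
def IsEssBounded (P : Measure Ω) (f : Ω → ℝ) : Prop :=
  Measurable f ∧ ∃ C, ∀ᵐ ω ∂P, |f ω| ≤ C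

variable {P : Measure Ω}

theorem IsEssBounded.integrable [IsFiniteMeasure P] {f : Ω → ℝ} (hf : IsEssBounded P f) :
    Integrable f P :=
  hf.2.elim fun C hC => Integrable.of_bound hf.1.aestronglyMeasurable C hC

theorem IsEssBounded.add {f g : Ω → ℝ} (hf : IsEssBounded P f) (hg : IsEssBounded P g) :
    IsEssBounded P fun ω => f ω + g ω := by
  obtain ⟨hf, C, hC⟩ := hf
  obtain ⟨hg, D, hD⟩ := hg
  refine ⟨hf.add hg, C + D, ?_⟩
  filter_upwards [hC, hD] with ω h1 h2
  exact (abs_add_le _ _).trans (add_le_add h1 h2)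

theorem IsEssBounded.mul {f g : Ω → ℝ} (hf : IsEssBounded P f) (hg : IsEssBounded P g) :
    IsEssBounded P fun ω => f ω * g ω := by
  obtain ⟨hf, C, hC⟩ := hf
  obtain ⟨hg, D, hD⟩ := hg
  refine ⟨hf.mul hg, C * D, ?_⟩
  filter_upwards [hC, hD] with ω h1 h2
  rw [abs_mul]
  exact mul_le_mul h1 h2 (abs_nonneg _) ((abs_nonneg _).trans h1)

theorem isEssBounded_const (c : ℝ) : IsEssBounded P fun _ => c :=
  ⟨measurable_const, |c|, Filter.Eventually.of_forall fun _ => le_rfl⟩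

theorem IsEssBounded.sum {s : Finset α} {f : α → Ω → ℝ} (hf : ∀ a, IsEssBounded P (f a)) :
    IsEssBounded P fun ω => ∑ a ∈ s, f a ω := by
  classical
  induction s using Finset.induction_on with
  | empty => simpa using isEssBounded_const 0
  | insert a s ha ih =>
    simp_rw [Finset.sum_insert ha]
    exact (hf a).add ih

theorem IsEssBounded.pow_two {f : Ω → ℝ} (hf : IsEssBounded P f) :
    IsEssBounded P fun ω => f ω ^ 2 := by
  simpa [_root_.pow_two] using hf.mul hf

/-- A family of independent random variables of mean zero that are bounded by `K`. -/
structure IsBoundedFamily (P : Measure Ω) (X : α → Ω → ℝ) (K : ℝ) : Prop where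
  measurable : ∀ a, Measurable (X a)
  indep : iIndepFun X P
  mean_zero : ∀ a, ∫ ω, X a ω ∂P = 0
  bounded : ∀ a, ∀ᵐ ω ∂P, |X a ω| ≤ K

variable {X : α → Ω → ℝ} {K : ℝ}

theorem IsBoundedFamily.isEssBounded (hX : IsBoundedFamily P X K) (a : α) :
    IsEssBounded P (X a) :=
  ⟨hX.measurable a, K, hX.bounded a⟩

theorem IsBoundedFamily.variance_eq (hX : IsBoundedFamily P X K) (a : α) :
    Var[X a; P] = ∫ ω, X a ω ^ 2 ∂P :=
  variance_of_integral_eq_zero (hX.measurable a).aemeasurable (hX.mean_zero a)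

theorem IsBoundedFamily.integral_mul (hX : IsBoundedFamily P X K) {a b : α} (h : a ≠ b) :
    ∫ ω, X a ω * X b ω ∂P = 0 := by
  rw [(hX.indep.indepFun h).integral_fun_mul_eq_mul_integral
    (hX.measurable a).aestronglyMeasurable (hX.measurable b).aestronglyMeasurable,
    hX.mean_zero a, zero_mul]

theorem IsBoundedFamily.integral_mul_ite [DecidableEq α] (hX : IsBoundedFamily P X K) (a b : α) :
    ∫ ω, X a ω * X b ω ∂P = if a = b then Var[X a; P] else 0 := by
  split_ifs with h
  · rw [h, hX.variance_eq]
    simp_rw [pow_two]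
  · exact hX.integral_mul h

variable [IsProbabilityMeasure P]

/-- A Chernoff bound for sums of bounded independent random variables, of Bernstein type. -/
theorem measureReal_sum_ge_le [Fintype α] {Y : α → Ω → ℝ} (hm : ∀ a, Measurable (Y a))
    (hi : iIndepFun Y P) {M : ℝ} (hM : ∀ a, ∀ᵐ ω ∂P, |Y a ω| ≤ M) (h0 : ∀ a, ∫ ω, Y a ω ∂P = 0)
    {V lam : ℝ} (hV : ∑ a, ∫ ω, Y a ω ^ 2 ∂P ≤ V) (hlam : 0 ≤ lam) (hlamM : lam * M ≤ 1) (t : ℝ) :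
    P.real {ω | t ≤ ∑ a, Y a ω} ≤ Real.exp (-(lam * t) + lam ^ 2 * V) := by
  have hb : ∀ a, IsEssBounded P (Y a) := fun a => ⟨hm a, M, hM a⟩
  have hbound : ∀ a, ∀ᵐ ω ∂P, |lam * Y a ω| ≤ 1 := fun a => by
    filter_upwards [hM a] with ω h
    rw [abs_mul, abs_of_nonneg hlam]
    exact (mul_le_mul_of_nonneg_left h hlam).trans hlamM
  -- From exp x ≤ 1 + x + x² for |x| ≤ 1, the vanishing mean, and 1 + x ≤ exp x.
  have hmgf : ∀ a, mgf (Y a) P lam ≤ Real.exp (lam ^ 2 * ∫ ω, Y a ω ^ 2 ∂P) := by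
    intro a
    have hI : Integrable (fun ω => 1 + lam * Y a ω + lam ^ 2 * Y a ω ^ 2) P :=
      (((isEssBounded_const 1).add ((isEssBounded_const lam).mul (hb a))).add
        ((isEssBounded_const (lam ^ 2)).mul (hb a).pow_two)).integrable
    have h1 : mgf (Y a) P lam ≤ ∫ ω, 1 + lam * Y a ω + lam ^ 2 * Y a ω ^ 2 ∂P := by
      refine integral_mono_of_nonneg (Filter.Eventually.of_forall fun _ => (Real.exp_pos _).le) hI ?_
      filter_upwards [hbound a] with ω h
      have := (abs_le.mp (Real.abs_exp_sub_one_sub_id_le h)).2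
      rw [← mul_pow]
      linarith
    have h2 : ∫ ω, 1 + lam * Y a ω + lam ^ 2 * Y a ω ^ 2 ∂P
        = 1 + lam ^ 2 * ∫ ω, Y a ω ^ 2 ∂P := by
      rw [integral_add ((isEssBounded_const 1).add ((isEssBounded_const lam).mul (hb a))).integrable
        ((isEssBounded_const (lam ^ 2)).mul (hb a).pow_two).integrable,
        integral_add (isEssBounded_const 1).integrable
        ((isEssBounded_const lam).mul (hb a)).integrable, integral_const_mul, integral_const_mul,
        h0 a]
      simp
    rw [h2] at h1
    linarith [Real.add_one_le_exp (lam ^ 2 * ∫ ω, Y a ω ^ 2 ∂P)]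
  have hint : Integrable (fun ω => Real.exp (lam * (∑ a, Y a) ω)) P := by
    have hms : Measurable (∑ a, Y a) := by
      have := Finset.measurable_sum (Finset.univ : Finset α) fun a _ => hm a
      simpa only [← Finset.sum_apply] using this
    refine Integrable.of_bound (Real.measurable_exp.comp (hms.const_mul lam)).aestronglyMeasurable
      (Real.exp (Fintype.card α)) ?_
    filter_upwards [ae_all_iff.mpr hbound] with ω h
    rw [Real.norm_of_nonneg (Real.exp_pos _).le, Real.exp_le_exp, Finset.sum_apply, Finset.mul_sum]
    calc ∑ a, lam * Y a ω ≤ ∑ _a : α, (1 : ℝ) :=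
          Finset.sum_le_sum fun a _ => (le_abs_self _).trans (h a)
      _ = _ := by simp
  have h1 := measure_ge_le_exp_mul_mgf (μ := P) (X := ∑ a, Y a) t hlam hint
  simp only [Finset.sum_apply] at h1
  refine h1.trans ?_
  rw [hi.mgf_sum hm, neg_mul, Real.exp_add]
  refine mul_le_mul_of_nonneg_left ?_ (Real.exp_pos _).le
  calc ∏ a, mgf (Y a) P lam ≤ ∏ a, Real.exp (lam ^ 2 * ∫ ω, Y a ω ^ 2 ∂P) :=
        Finset.prod_le_prod (fun _ _ => mgf_nonneg) fun a _ => hmgf a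
    _ = Real.exp (lam ^ 2 * ∑ a, ∫ ω, Y a ω ^ 2 ∂P) := by
        rw [← Real.exp_sum, Finset.mul_sum]
    _ ≤ _ := by gcongr

theorem measureReal_abs_sum_ge_le [Fintype α] {Y : α → Ω → ℝ} (hm : ∀ a, Measurable (Y a))
    (hi : iIndepFun Y P) {M : ℝ} (hM : ∀ a, ∀ᵐ ω ∂P, |Y a ω| ≤ M) (h0 : ∀ a, ∫ ω, Y a ω ∂P = 0)
    {V lam : ℝ} (hV : ∑ a, ∫ ω, Y a ω ^ 2 ∂P ≤ V) (hlam : 0 ≤ lam) (hlamM : lam * M ≤ 1) (t : ℝ) :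
    P.real {ω | t ≤ |∑ a, Y a ω|} ≤ 2 * Real.exp (-(lam * t) + lam ^ 2 * V) := by
  have h1 := measureReal_sum_ge_le hm hi hM h0 hV hlam hlamM t
  have h2 := measureReal_sum_ge_le (Y := fun a ω => -Y a ω) (fun a => (hm a).neg)
    (hi.comp (fun _ x => -x) fun _ => measurable_neg) (M := M) (V := V) (by simpa using hM)
    (fun a => by rw [integral_neg, h0 a, neg_zero]) (by simpa using hV) hlam hlamM t
  have hsub : {ω | t ≤ |∑ a, Y a ω|} ⊆ {ω | t ≤ ∑ a, Y a ω} ∪ {ω | t ≤ ∑ a, -Y a ω} := by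
    intro ω h
    simp only [Set.mem_ofPred_eq, le_abs] at h
    simpa [Finset.sum_neg_distrib] using h
  calc _ ≤ P.real ({ω | t ≤ ∑ a, Y a ω} ∪ {ω | t ≤ ∑ a, -Y a ω}) := measureReal_mono hsub
    _ ≤ _ := measureReal_union_le _ _
    _ ≤ _ := by linarith

/-- A linear combination with coefficients of Euclidean norm at most `1` has Bernstein tails. -/
theorem IsBoundedFamily.measureReal_linear_le [Fintype α] (hX : IsBoundedFamily P X K)
    (hK : 0 ≤ K) {σ t : ℝ} (hσ : ∀ a, Var[X a; P] ≤ σ ^ 2) (ht : 0 < t)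
    (hD : 0 < 2 * σ ^ 2 + K * t) {c : α → ℝ} (hc : ∑ a, c a ^ 2 ≤ 1) :
    P.real {ω | 2 * t ≤ |∑ a, c a * X a ω|} ≤ 2 * Real.exp (-(t ^ 2 / (2 * σ ^ 2 + K * t))) := by
  set D := 2 * σ ^ 2 + K * t with hDdef
  have hc1 : ∀ a, |c a| ≤ 1 := fun a => by
    rw [← sq_le_one_iff_abs_le_one]
    exact (Finset.single_le_sum (f := fun a => c a ^ 2) (fun _ _ => sq_nonneg _)
      (Finset.mem_univ a)).trans hc
  -- With λ = t/D the exponent is -2t²/D + t²σ²/D² ≤ -t²/D. The threshold 2t thus gives twice the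
  -- exponent of the final statement, which later pays for the union bound.
  refine (measureReal_abs_sum_ge_le (Y := fun a ω => c a * X a ω) (M := K) (V := σ ^ 2)
    (lam := t / D) (fun a => (hX.measurable a).const_mul _)
    (hX.indep.comp (fun a x => c a * x) fun a => measurable_id.const_mul _) (fun a => ?_)
    (fun a => by rw [integral_const_mul, hX.mean_zero, mul_zero]) ?_ (by positivity) ?_
    (2 * t)).trans ?_
  · filter_upwards [hX.bounded a] with ω h
    rw [abs_mul]
    nlinarith [mul_le_mul (hc1 a) h (abs_nonneg _) zero_le_one]
  · calc ∑ a, ∫ ω, (c a * X a ω) ^ 2 ∂P ≤ ∑ a, c a ^ 2 * σ ^ 2 := by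
          refine Finset.sum_le_sum fun a _ => ?_
          simp_rw [mul_pow]
          rw [integral_const_mul, ← hX.variance_eq]
          exact mul_le_mul_of_nonneg_left (hσ a) (sq_nonneg _)
      _ = (∑ a, c a ^ 2) * σ ^ 2 := by rw [Finset.sum_mul]
      _ ≤ 1 * σ ^ 2 := by gcongr
      _ = σ ^ 2 := one_mul _
  · rw [div_mul_eq_mul_div, div_le_one hD]
    nlinarith [sq_nonneg σ]
  · gcongr
    have h1 : (t / D) ^ 2 * σ ^ 2 ≤ t ^ 2 / D := by
      rw [div_pow, div_mul_eq_mul_div, div_le_div_iff₀ (by positivity) hD]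
      have : t ^ 2 * D * σ ^ 2 ≤ t ^ 2 * D * D := by
        gcongr
        nlinarith [sq_nonneg σ, mul_nonneg hK ht.le]
      nlinarith
    have h2 : t / D * (2 * t) = 2 * (t ^ 2 / D) := by ring
    rw [h2]
    linarith

/-- The hypotheses of the Chernoff bound for centred squares; the variance estimate uses 𝔼X⁴ ≤ K²
𝔼X² and c² ≤ |c|. -/
theorem IsBoundedFamily.weighted_square [Fintype α] (hX : IsBoundedFamily P X K)
    {c : α → ℝ} (hc : ∀ a, |c a| ≤ 1) :
    (∀ a, Measurable fun ω => c a * (X a ω ^ 2 - Var[X a; P])) ∧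
    iIndepFun (fun a ω => c a * (X a ω ^ 2 - Var[X a; P])) P ∧
    (∀ a, ∀ᵐ ω ∂P, |c a * (X a ω ^ 2 - Var[X a; P])| ≤ K ^ 2) ∧
    (∀ a, ∫ ω, c a * (X a ω ^ 2 - Var[X a; P]) ∂P = 0) ∧
    ∑ a, ∫ ω, (c a * (X a ω ^ 2 - Var[X a; P])) ^ 2 ∂P ≤ K ^ 2 * ∑ a, |c a| * Var[X a; P] := by
  have hsq : ∀ a, ∀ᵐ ω ∂P, X a ω ^ 2 ≤ K ^ 2 := fun a => by
    filter_upwards [hX.bounded a] with ω h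
    exact sq_le_sq' (by linarith [(abs_le.mp h).1]) (abs_le.mp h).2
  have hv : ∀ a, Var[X a; P] ≤ K ^ 2 := fun a => by
    rw [hX.variance_eq]
    calc ∫ ω, X a ω ^ 2 ∂P ≤ ∫ _ω, K ^ 2 ∂P :=
          integral_mono_ae (hX.isEssBounded a).pow_two.integrable
            (isEssBounded_const _).integrable (hsq a)
      _ = K ^ 2 := by simp
  refine ⟨fun a => (((hX.measurable a).pow_const 2).sub_const _).const_mul _,
    hX.indep.comp (fun a x => c a * (x ^ 2 - Var[X a; P])) fun a =>
      ((measurable_id.pow_const 2).sub_const _).const_mul _, fun a => ?_, fun a => ?_, ?_⟩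
  · filter_upwards [hsq a] with ω h
    have h1 : |X a ω ^ 2 - Var[X a; P]| ≤ K ^ 2 := by
      rw [abs_le]
      constructor <;> nlinarith [hv a, sq_nonneg (X a ω), variance_nonneg (X a) P]
    rw [abs_mul]
    nlinarith [mul_le_mul (hc a) h1 (abs_nonneg _) zero_le_one]
  · rw [integral_const_mul, integral_sub (hX.isEssBounded a).pow_two.integrable
      (isEssBounded_const _).integrable, ← hX.variance_eq]
    simp
  · rw [Finset.mul_sum]
    refine Finset.sum_le_sum fun a _ => ?_
    have hb := hX.isEssBounded a
    set v := Var[X a; P] with hvdef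
    have hv0 : 0 ≤ v := variance_nonneg _ _
    have h1 : ∫ ω, (X a ω ^ 2 - v) ^ 2 ∂P ≤ K ^ 2 * v := by
      have h2 : ∫ ω, (X a ω ^ 2 - v) ^ 2 ∂P ≤ ∫ ω, (K ^ 2 - 2 * v) * X a ω ^ 2 + v ^ 2 ∂P := by
        refine integral_mono_of_nonneg (Filter.Eventually.of_forall fun _ => sq_nonneg _)
          (((isEssBounded_const _).mul hb.pow_two).add (isEssBounded_const _)).integrable ?_
        filter_upwards [hsq a] with ω h
        nlinarith [mul_le_mul_of_nonneg_right h (sq_nonneg (X a ω))]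
      rw [integral_add ((isEssBounded_const _).mul hb.pow_two).integrable
        (isEssBounded_const _).integrable, integral_const_mul, ← hX.variance_eq, ← hvdef] at h2
      simp only [integral_const, probReal_univ, one_smul] at h2
      nlinarith [sq_nonneg v]
    simp_rw [mul_pow]
    rw [integral_const_mul]
    have h3 : c a ^ 2 ≤ |c a| := by
      rw [← sq_abs]
      nlinarith [abs_nonneg (c a), hc a]
    have h4 : 0 ≤ K ^ 2 * v := by positivity
    calc c a ^ 2 * ∫ ω, (X a ω ^ 2 - v) ^ 2 ∂P ≤ c a ^ 2 * (K ^ 2 * v) := by gcongr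
      _ ≤ |c a| * (K ^ 2 * v) := by gcongr
      _ = _ := by ring

/-- The tails of a weighted sum of squares, on the event that the sum of squares is small. -/
theorem IsBoundedFamily.measureReal_diagonal_le [Fintype α] (hX : IsBoundedFamily P X K)
    {w : α → ℝ} (hw : ∀ a, |w a| ≤ 1) {l t s : ℝ} (hK : 0 ≤ K) (hl : 0 ≤ l)
    (hlK : l * K ≤ t) (hKt : 2 * K ≤ t) (ht : 0 < t) (hts : 384 * t ≤ s) :
    P.real {ω | ∑ a, |w a| * X a ω ^ 2 ≤ s ^ 2 / 96 ^ 2 ∧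
      t * s ≤ |∑ a, w a * (X a ω ^ 2 - Var[X a; P])|} ≤ 2 * Real.exp (-l) := by
  have hs : 0 < s := by linarith
  set L := ∑ a, |w a| * Var[X a; P] with hL
  have hL0 : 0 ≤ L := Finset.sum_nonneg fun a _ => mul_nonneg (abs_nonneg _) (variance_nonneg _ _)
  have hlK2 : l * K ^ 2 ≤ t ^ 2 / 2 := by nlinarith
  have hlK2' : (l * K) ^ 2 ≤ t ^ 2 := pow_le_pow_left₀ (by positivity) hlK 2
  -- If the expected sum of squares L is small, the Chernoff bound applies to the weighted sum
  -- directly. If it is large, the constraint that the sum be at most s²/96² is itself a lower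
  -- deviation by more than L/2, which is rare.
  rcases le_total L (s ^ 2 / 2) with hsmall | hlarge
  · obtain ⟨h1, h2, h3, h4, h5⟩ := hX.weighted_square hw
    have hb := measureReal_abs_sum_ge_le h1 h2 h3 h4 h5 (lam := 2 * l / (t * s)) (by positivity)
      (by
        rw [div_mul_eq_mul_div, div_le_one (by positivity)]
        nlinarith) (t * s)
    refine (measureReal_mono (fun ω h => h.2)).trans (hb.trans ?_)
    gcongr
    have e1 : 2 * l / (t * s) * (t * s) = 2 * l := by field_simp
    have e2 : (2 * l / (t * s)) ^ 2 * (K ^ 2 * L) ≤ l := by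
      rw [div_pow, div_mul_eq_mul_div, div_le_iff₀ (by positivity)]
      calc (2 * l) ^ 2 * (K ^ 2 * L) = 4 * l * (l * K ^ 2) * L := by ring
        _ ≤ 4 * l * (t ^ 2 / 2) * (s ^ 2 / 2) := by gcongr
        _ = l * (t * s) ^ 2 := by ring
    rw [e1]
    linarith
  · have hLpos : 0 < L := by nlinarith
    obtain ⟨h1, h2, h3, h4, h5⟩ := hX.weighted_square (c := fun a => -|w a|) (by simpa using hw)
    simp only [abs_neg, abs_abs] at h5
    have hts2 : (384 * t) ^ 2 ≤ s ^ 2 := pow_le_pow_left₀ (by positivity) hts 2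
    have hb := measureReal_sum_ge_le h1 h2 h3 h4 h5 (lam := 4 * l / L) (by positivity)
      (by
        rw [div_mul_eq_mul_div, div_le_one hLpos]
        nlinarith) (L / 2)
    have hsub : {ω | ∑ a, |w a| * X a ω ^ 2 ≤ s ^ 2 / 96 ^ 2 ∧
        t * s ≤ |∑ a, w a * (X a ω ^ 2 - Var[X a; P])|} ⊆
        {ω | L / 2 ≤ ∑ a, -|w a| * (X a ω ^ 2 - Var[X a; P])} := by
      rintro ω ⟨h, -⟩
      have : ∑ a, -|w a| * (X a ω ^ 2 - Var[X a; P]) = L - ∑ a, |w a| * X a ω ^ 2 := by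
        rw [hL, ← Finset.sum_sub_distrib]
        exact Finset.sum_congr rfl fun a _ => by ring
      simp only [Set.mem_ofPred_eq, this]
      nlinarith [sq_nonneg s]
    refine (measureReal_mono hsub).trans (hb.trans ?_)
    have e1 : 4 * l / L * (L / 2) = 2 * l := by field_simp; ring
    have e2 : (4 * l / L) ^ 2 * (K ^ 2 * L) ≤ l := by
      rw [div_pow, div_mul_eq_mul_div, div_le_iff₀ (by positivity)]
      calc (4 * l) ^ 2 * (K ^ 2 * L) = 16 * (l * K ^ 2) * (l * L) := by ring
        _ ≤ L * (l * L) := by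
            gcongr
            nlinarith
        _ = l * L ^ 2 := by ring
    rw [e1]
    have : Real.exp (-(2 * l) + (4 * l / L) ^ 2 * (K ^ 2 * L)) ≤ Real.exp (-l) := by
      gcongr
      linarith
    linarith [Real.exp_pos (-l)]

/-- The second moment of a quadratic form without diagonal terms. -/
theorem IsBoundedFamily.integral_chaos_sq_le [DecidableEq α] (hX : IsBoundedFamily P X K)
    {c : α → α → ℝ} (hc : ∀ a, c a a = 0) (S : Finset α) :
    ∫ ω, (∑ a ∈ S, ∑ b ∈ S, c a b * (X a ω * X b ω)) ^ 2 ∂P ≤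
      2 * ∑ a ∈ S, ∑ b ∈ S, c a b ^ 2 * (Var[X a; P] * Var[X b; P]) := by
  induction S using Finset.induction_on with
  | empty => simp
  | insert i S hi ih =>
    set Q : Ω → ℝ := fun ω => ∑ a ∈ S, ∑ b ∈ S, c a b * (X a ω * X b ω) with hQ
    set L : Ω → ℝ := fun ω => ∑ b ∈ S, (c i b + c b i) * X b ω with hL
    have hXb := hX.isEssBounded
    have hQb : IsEssBounded P Q := IsEssBounded.sum fun a => IsEssBounded.sum fun b =>
      (isEssBounded_const _).mul ((hXb a).mul (hXb b))
    have hLb : IsEssBounded P L := IsEssBounded.sum fun b => (isEssBounded_const _).mul (hXb b)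
    have hind : IndepFun (fun ω (j : ({i} : Finset α)) => X j ω) (fun ω (j : S) => X j ω) P :=
      hX.indep.indepFun_finset {i} S (Finset.disjoint_singleton_left.mpr hi) hX.measurable
    have hsum : ∀ ω, ∑ a ∈ insert i S, ∑ b ∈ insert i S, c a b * (X a ω * X b ω)
        = Q ω + X i ω * L ω := by
      intro ω
      have h1 : X i ω * L ω = ∑ b ∈ S, c i b * (X i ω * X b ω)
          + ∑ a ∈ S, c a i * (X a ω * X i ω) := by
        rw [hL, Finset.mul_sum, ← Finset.sum_add_distrib]
        exact Finset.sum_congr rfl fun b _ => by ring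
      rw [h1, Finset.sum_insert hi, Finset.sum_insert hi, hc]
      simp_rw [Finset.sum_insert hi]
      rw [Finset.sum_add_distrib]
      ring
    have hLS : ∀ ω, L ω = ∑ b : S, (c i b + c b i) * X b ω := fun ω =>
      (Finset.sum_coe_sort S fun b => (c i b + c b i) * X b ω).symm
    have hQS : ∀ ω, Q ω = ∑ a : S, ∑ b : S, c a b * (X a ω * X b ω) := fun ω => by
      rw [Finset.sum_coe_sort S fun a => ∑ b : S, c a b * (X a ω * X b ω)]
      exact Finset.sum_congr rfl fun a _ =>
        (Finset.sum_coe_sort S fun b => c a b * (X a ω * X b ω)).symm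
    -- L and Q depend only on the variables in `S`, hence are independent of the centred X_i; the
    -- new second moment is a plain sum.
    have hcross : ∫ ω, X i ω * (L ω * Q ω) ∂P = 0 := by
      have h1 : IndepFun (X i) (fun ω => L ω * Q ω) P := by
        have hφ : Measurable fun y : ({i} : Finset α) → ℝ => y ⟨i, Finset.mem_singleton_self i⟩ :=
          measurable_pi_apply _
        have := hind.comp hφ
          (ψ := fun y : S → ℝ => (∑ b : S, (c i b + c b i) * y b) *
            ∑ a : S, ∑ b : S, c a b * (y a * y b)) (by fun_prop)
        simpa only [Function.comp_def, ← hLS, ← hQS] using this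
      rw [h1.integral_fun_mul_eq_mul_integral (hX.measurable i).aestronglyMeasurable
        (hLb.mul hQb).1.aestronglyMeasurable, hX.mean_zero, zero_mul]
    have hsqr : ∫ ω, X i ω ^ 2 * L ω ^ 2 ∂P = Var[X i; P] * ∫ ω, L ω ^ 2 ∂P := by
      have h1 : IndepFun (fun ω => X i ω ^ 2) (fun ω => L ω ^ 2) P := by
        have := hind.comp (φ := fun y : ({i} : Finset α) → ℝ => y ⟨i, Finset.mem_singleton_self i⟩ ^ 2)
          (ψ := fun y : S → ℝ => (∑ b : S, (c i b + c b i) * y b) ^ 2) (by fun_prop) (by fun_prop)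
        simpa only [Function.comp_def, ← hLS] using this
      rw [h1.integral_fun_mul_eq_mul_integral (hXb i).pow_two.1.aestronglyMeasurable
        hLb.pow_two.1.aestronglyMeasurable, hX.variance_eq]
    have hLsq : ∫ ω, L ω ^ 2 ∂P = ∑ b ∈ S, (c i b + c b i) ^ 2 * Var[X b; P] := by
      have h1 : ∀ ω, L ω ^ 2 = ∑ a ∈ S, ∑ b ∈ S,
          ((c i a + c a i) * (c i b + c b i)) * (X a ω * X b ω) := by
        intro ω
        rw [hL, pow_two, Finset.sum_mul_sum]
        exact Finset.sum_congr rfl fun a _ => Finset.sum_congr rfl fun b _ => by ring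
      simp_rw [h1]
      rw [integral_finsetSum _ fun a _ => (IsEssBounded.sum fun b =>
        (isEssBounded_const _).mul ((hXb a).mul (hXb b))).integrable]
      refine Finset.sum_congr rfl fun a ha => ?_
      rw [integral_finsetSum _ fun b _ =>
        ((isEssBounded_const _).mul ((hXb a).mul (hXb b))).integrable]
      simp_rw [integral_const_mul, hX.integral_mul_ite]
      simp [ha, pow_two]
    have hexp : ∫ ω, (Q ω + X i ω * L ω) ^ 2 ∂P
        = ∫ ω, Q ω ^ 2 ∂P + Var[X i; P] * ∑ b ∈ S, (c i b + c b i) ^ 2 * Var[X b; P] := by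
      have h1 : ∀ ω, (Q ω + X i ω * L ω) ^ 2
          = Q ω ^ 2 + 2 * (X i ω * (L ω * Q ω)) + X i ω ^ 2 * L ω ^ 2 := fun ω => by ring
      simp_rw [h1]
      rw [integral_add (hQb.pow_two.add ((isEssBounded_const 2).mul
          ((hXb i).mul (hLb.mul hQb)))).integrable ((hXb i).pow_two.mul hLb.pow_two).integrable,
        integral_add hQb.pow_two.integrable ((isEssBounded_const 2).mul
          ((hXb i).mul (hLb.mul hQb))).integrable, integral_const_mul, hcross, hsqr, hLsq]
      ring
    simp_rw [hsum]
    rw [hexp]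
    have hlast : Var[X i; P] * ∑ b ∈ S, (c i b + c b i) ^ 2 * Var[X b; P] ≤
        2 * ∑ b ∈ S, c i b ^ 2 * (Var[X i; P] * Var[X b; P])
        + 2 * ∑ b ∈ S, c b i ^ 2 * (Var[X b; P] * Var[X i; P]) := by
      rw [← mul_add, ← Finset.sum_add_distrib, Finset.mul_sum, Finset.mul_sum]
      refine Finset.sum_le_sum fun b _ => ?_
      have h1 : 0 ≤ Var[X i; P] * Var[X b; P] :=
        mul_nonneg (variance_nonneg _ _) (variance_nonneg _ _)
      nlinarith [mul_nonneg h1 (sq_nonneg (c i b - c b i))]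
    simp only [Finset.sum_insert hi, hc, Finset.sum_add_distrib]
    nlinarith

end Concentration

/-! ### Tails of quadratic forms -/

section QuadraticForms

variable {Ω α : Type*} [MeasurableSpace Ω] {P : Measure Ω} [IsProbabilityMeasure P] {K : ℝ}

/-- The tails of a quadratic form, on the event that its diagonal part is small. -/
theorem IsBoundedFamily.measureReal_quadratic_le [Fintype α] {X : α → Ω → ℝ}
    (hX : IsBoundedFamily P X K) {c : α → α → ℝ} (hc : ∀ a, |c a a| ≤ 1) {l t s t₂ : ℝ}
    (hK : 0 ≤ K) (hl : 0 ≤ l) (hlK : l * K ≤ t) (hKt : 2 * K ≤ t) (ht : 0 < t)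
    (hts : 384 * t ≤ s) (ht₂ : 0 < t₂) :
    P.real {ω | ∑ a, |c a a| * X a ω ^ 2 ≤ s ^ 2 / 96 ^ 2 ∧
      t₂ + |∫ ω, ∑ a, ∑ b, c a b * (X a ω * X b ω) ∂P| + t * s
        < |∑ a, ∑ b, c a b * (X a ω * X b ω)|} ≤
      2 * (∑ a, ∑ b, c a b ^ 2 * (Var[X a; P] * Var[X b; P])) / t₂ ^ 2 + 2 * Real.exp (-l) := by
  classical
  have hXb := hX.isEssBounded
  -- The off-diagonal part costs t₂ by Chebyshev, the centred diagonal costs t s exponentially, and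
  -- what remains is the mean.
  set d : α → α → ℝ := fun a b => if a = b then 0 else c a b with hd
  set Q : Ω → ℝ := fun ω => ∑ a, ∑ b, d a b * (X a ω * X b ω) with hQ
  have hmean : ∫ ω, ∑ a, ∑ b, c a b * (X a ω * X b ω) ∂P = ∑ a, c a a * Var[X a; P] := by
    rw [integral_finsetSum _ fun a _ => (IsEssBounded.sum fun b =>
      (isEssBounded_const _).mul ((hXb a).mul (hXb b))).integrable]
    refine Finset.sum_congr rfl fun a ha => ?_
    rw [integral_finsetSum _ fun b _ =>
      ((isEssBounded_const _).mul ((hXb a).mul (hXb b))).integrable]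
    simp_rw [integral_const_mul, hX.integral_mul_ite]
    simp
  have hsplit : ∀ ω, ∑ a, ∑ b, c a b * (X a ω * X b ω) = Q ω
      + ∑ a, c a a * (X a ω ^ 2 - Var[X a; P]) + ∑ a, c a a * Var[X a; P] := by
    intro ω
    rw [hQ, ← Finset.sum_add_distrib, ← Finset.sum_add_distrib]
    refine Finset.sum_congr rfl fun a _ => ?_
    rw [← Finset.add_sum_erase _ _ (Finset.mem_univ a),
      ← Finset.add_sum_erase (f := fun b => d a b * (X a ω * X b ω)) _ (Finset.mem_univ a)]
    have : ∑ b ∈ Finset.univ.erase a, d a b * (X a ω * X b ω)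
        = ∑ b ∈ Finset.univ.erase a, c a b * (X a ω * X b ω) :=
      Finset.sum_congr rfl fun b hb => by
        rw [hd]; simp only; rw [if_neg (Finset.ne_of_mem_erase hb).symm]
    rw [this]
    simp only [hd, if_true]
    ring
  have hQsq : ∫ ω, Q ω ^ 2 ∂P ≤ 2 * ∑ a, ∑ b, c a b ^ 2 * (Var[X a; P] * Var[X b; P]) := by
    refine (hX.integral_chaos_sq_le (c := d) (fun a => if_pos rfl) Finset.univ).trans ?_
    refine mul_le_mul_of_nonneg_left (Finset.sum_le_sum fun a _ => Finset.sum_le_sum fun b _ =>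
      mul_le_mul_of_nonneg_right ?_ (mul_nonneg (variance_nonneg _ _) (variance_nonneg _ _)))
      zero_le_two
    simp only [hd]
    split_ifs
    · simp [sq_nonneg]
    · exact le_rfl
  have hQint : Integrable (fun ω => Q ω ^ 2) P :=
    (IsEssBounded.sum fun a => IsEssBounded.sum fun b =>
      (isEssBounded_const (d a b)).mul ((hXb a).mul (hXb b))).pow_two.integrable
  have hcheb : P.real {ω | t₂ ^ 2 ≤ Q ω ^ 2} ≤
      2 * (∑ a, ∑ b, c a b ^ 2 * (Var[X a; P] * Var[X b; P])) / t₂ ^ 2 := by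
    rw [le_div_iff₀ (by positivity), mul_comm]
    exact (mul_meas_ge_le_integral_of_nonneg
      (Filter.Eventually.of_forall fun ω => sq_nonneg (Q ω)) hQint _).trans hQsq
  have hdiag := hX.measureReal_diagonal_le (w := fun a => c a a) hc hK hl hlK hKt ht hts
  refine (measureReal_mono ?_).trans ((measureReal_union_le _ _).trans (add_le_add hcheb hdiag))
  rintro ω ⟨h1, h2⟩
  by_cases hq : t₂ ^ 2 ≤ Q ω ^ 2
  · exact Or.inl hq
  · refine Or.inr ⟨h1, ?_⟩
    rw [hmean, hsplit] at h2
    push Not at hq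
    have h3 := abs_lt_of_sq_lt_sq hq ht₂.le
    have h5 := abs_add_three (Q ω) (∑ a, c a a * (X a ω ^ 2 - Var[X a; P]))
      (∑ a, c a a * Var[X a; P])
    linarith

end QuadraticForms

/-! ### Matrices as operators on Euclidean space -/

section Matrices

variable {m n : ℕ}

/-- A matrix as an operator between Euclidean spaces. -/
noncomputable def toCLM :
    Matrix (Fin m) (Fin n) ℝ ≃ₗ[ℝ] (EuclideanSpace ℝ (Fin n) →L[ℝ] EuclideanSpace ℝ (Fin m)) :=
  Matrix.toEuclideanLin.trans LinearMap.toContinuousLinearMap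

theorem norm_toCLM (M : Matrix (Fin m) (Fin n) ℝ) : ‖toCLM M‖ = ‖M‖ := rfl

theorem ofLp_toCLM (M : Matrix (Fin m) (Fin n) ℝ) (x : EuclideanSpace ℝ (Fin n)) :
    (toCLM M x).ofLp = M *ᵥ x.ofLp := rfl

theorem inner_eq_dotProduct (x y : EuclideanSpace ℝ (Fin n)) :
    ⟪x, y⟫_ℝ = x.ofLp ⬝ᵥ y.ofLp := by
  rw [EuclideanSpace.inner_eq_star_dotProduct, dotProduct_comm]
  simp

theorem adjoint_toCLM (M : Matrix (Fin m) (Fin n) ℝ) :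
    ContinuousLinearMap.adjoint (toCLM M) = toCLM Mᵀ := by
  symm
  rw [ContinuousLinearMap.eq_adjoint_iff]
  intro w z
  rw [inner_eq_dotProduct, inner_eq_dotProduct, ofLp_toCLM, ofLp_toCLM, Matrix.mulVec_transpose,
    Matrix.dotProduct_mulVec]

theorem norm_transpose (M : Matrix (Fin m) (Fin n) ℝ) : ‖Mᵀ‖ = ‖M‖ := by
  rw [← norm_toCLM, ← norm_toCLM, ← adjoint_toCLM]
  exact ContinuousLinearMap.adjoint.norm_map _

theorem toCLM_vecMulVec (u : EuclideanSpace ℝ (Fin m)) (v : EuclideanSpace ℝ (Fin n))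
    (z : EuclideanSpace ℝ (Fin n)) :
    toCLM (Matrix.vecMulVec u.ofLp v.ofLp) z = ⟪v, z⟫_ℝ • u := by
  refine WithLp.ofLp_injective 2 ?_
  rw [ofLp_toCLM, Matrix.vecMulVec_mulVec, inner_eq_dotProduct]
  ext i
  simp [mul_comm]

theorem toCLM_sum_vecMulVec {ι : Type*} [Fintype ι] (s : ι → ℝ)
    (u : ι → EuclideanSpace ℝ (Fin m)) (v : ι → EuclideanSpace ℝ (Fin n)) :
    toCLM (∑ i, s i • Matrix.vecMulVec (u i).ofLp (v i).ofLp) = lowRank s u v := by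
  ext1 z
  rw [map_sum, lowRank_apply, sum_apply]
  refine Finset.sum_congr rfl fun i _ => ?_
  rw [map_smul, smul_apply, toCLM_vecMulVec, smul_smul]

theorem SVD.toCLM_eq {M : Matrix (Fin m) (Fin n) ℝ} (S : SVD M) :
    toCLM M = lowRank (fun i : Fin M.rank => sval M (i + 1)) S.u S.v := by
  rw [← toCLM_sum_vecMulVec, ← S.eq_sum]

theorem SVD.toCLM_approx {M : Matrix (Fin m) (Fin n) ℝ} (S : SVD M) (p : ℕ) :
    toCLM (S.approx p) =
      lowRank (head p fun i : Fin M.rank => sval M (i + 1)) (head p S.u) (head p S.v) := by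
  rw [← toCLM_sum_vecMulVec, SVD.approx]
  congr 1
  exact Finset.sum_subtype _ (by simp) _

theorem sval_antitone (M : Matrix (Fin m) (Fin n) ℝ) {i j : ℕ} (h : i ≤ j) :
    sval M j ≤ sval M i :=
  (Matrix.toEuclideanLin M).singularValues_antitone (by omega)

theorem sval_nonneg (M : Matrix (Fin m) (Fin n) ℝ) (i : ℕ) : 0 ≤ sval M i :=
  (Matrix.toEuclideanLin M).singularValues_nonneg _

theorem sum_sq_eq_one {x : EuclideanSpace ℝ (Fin n)} (hx : ‖x‖ = 1) : ∑ i, x i ^ 2 = 1 := by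
  have := EuclideanSpace.norm_sq_eq x
  rw [hx] at this
  simpa using this.symm

theorem sum_column_sq_le (M : Matrix (Fin m) (Fin n) ℝ) (j : Fin n) :
    ∑ i, M i j ^ 2 ≤ ‖M‖ ^ 2 := by
  have h1 := (toCLM M).le_opNorm (EuclideanSpace.single j 1)
  rw [norm_toCLM, PiLp.norm_single, norm_one, mul_one] at h1
  have h2 := EuclideanSpace.norm_sq_eq (toCLM M (EuclideanSpace.single j 1))
  have h3 : ∀ i, (toCLM M (EuclideanSpace.single j 1)).ofLp i = M i j := fun i => by
    rw [ofLp_toCLM]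
    simp
  simp only [h3, Real.norm_eq_abs, sq_abs] at h2
  rw [← h2]
  gcongr

end Matrices

/-! ### Bilinear and Gram entries of the noise -/

section RandomMatrices

variable {Ω : Type*} [MeasurableSpace Ω] {P : Measure Ω} {m n : ℕ}
  {E : Ω → Matrix (Fin m) (Fin n) ℝ} {K σ : ℝ}

theorem IsBoundedNoise.isBoundedFamily (hE : IsBoundedNoise P E K σ) :
    IsBoundedFamily P (fun (a : Fin m × Fin n) ω => E ω a.1 a.2) K where
  measurable a := hE.measurable a.1 a.2
  indep := hE.indep
  mean_zero a := hE.mean_zero a.1 a.2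
  bounded a := by
    filter_upwards [hE.bounded] with ω h
    exact h a.1 a.2

theorem IsBoundedNoise.isBoundedFamily_transpose (hE : IsBoundedNoise P E K σ) :
    IsBoundedFamily P (fun (a : Fin n × Fin m) ω => (E ω)ᵀ a.1 a.2) K where
  measurable a := hE.measurable a.2 a.1
  indep := hE.indep.precomp (g := Prod.swap) Prod.swap_injective
  mean_zero a := hE.mean_zero a.2 a.1
  bounded a := by
    filter_upwards [hE.bounded] with ω h
    exact h a.2 a.1

/-- The average runs over m entries; m ≤ n weakens the factor to n, giving columns and rows the same
bound. -/
theorem sum_column_variance_le (hm : 0 < m) (hmn : m ≤ n) (j : Fin n) :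
    ∑ i, Var[fun ω => E ω i j; P] ^ 2 ≤ n * mFour P E := by
  have h1 : 1 / (m : ℝ) * ∑ i : Fin m, Var[fun ω => E ω i j; P] ^ 2 ≤ mFour P E :=
    (le_ciSup (f := fun k : Fin n => 1 / (m : ℝ) * ∑ i : Fin m, Var[fun ω => E ω i k; P] ^ 2)
      (Set.finite_range _).bddAbove j).trans (le_max_left _ _)
  have hm' : (0 : ℝ) < m := by exact_mod_cast hm
  rw [one_div, inv_mul_le_iff₀ hm'] at h1
  have h2 : 0 ≤ mFour P E := by
    have : 0 ≤ (m : ℝ) * mFour P E := h1.trans' (Finset.sum_nonneg fun _ _ => sq_nonneg _)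
    exact nonneg_of_mul_nonneg_right this hm'
  refine h1.trans ?_
  gcongr

theorem sum_row_variance_le (hn : 0 < n) (i : Fin m) :
    ∑ j, Var[fun ω => (E ω)ᵀ j i; P] ^ 2 ≤ n * mFour P E := by
  have h1 : 1 / (n : ℝ) * ∑ j : Fin n, Var[fun ω => E ω i j; P] ^ 2 ≤ mFour P E :=
    (le_ciSup (f := fun l : Fin m => 1 / (n : ℝ) * ∑ j : Fin n, Var[fun ω => E ω l j; P] ^ 2)
      (Set.finite_range _).bddAbove i).trans (le_max_right _ _)
  rwa [one_div, inv_mul_le_iff₀ (by exact_mod_cast hn)] at h1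

theorem mFour_nonneg : 0 ≤ mFour P E :=
  le_max_of_le_left (Real.iSup_nonneg fun _ =>
    mul_nonneg (by positivity) (Finset.sum_nonneg fun _ _ => sq_nonneg _))

theorem card_lt_pairs (r : ℕ) :
    (Fintype.card {a : Fin r × Fin r // a.1 < a.2} : ℝ) = r * (r - 1) / 2 := by
  have h1 : Fintype.card {a : Fin r × Fin r // a.1 < a.2} = ∑ i ∈ Finset.range r, i := by
    rw [← Fin.sum_univ_eq_sum_range (fun i => i), Fintype.card_subtype, Finset.card_filter,
      Fintype.sum_prod_type, Finset.sum_comm]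
    refine Finset.sum_congr rfl fun b _ => ?_
    rw [← Finset.card_filter]
    have : (Finset.univ.filter fun a : Fin r => a < b) = Finset.Iio b := by ext; simp
    rw [this, Fin.card_Iio]
  have h2 := Finset.sum_range_id_mul_two r
  rw [← h1] at h2
  have h3 : ((Fintype.card {a : Fin r × Fin r // a.1 < a.2} * 2 : ℕ) : ℝ) = r * (r - 1) := by
    rw [h2]
    rcases r with _ | r <;> simp
  push_cast at h3
  linarith

variable [IsProbabilityMeasure P]

theorem IsBoundedNoise.measureReal_bilinear_le (hE : IsBoundedNoise P E K σ) (hK : 0 ≤ K) {t : ℝ}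
    (ht : 0 < t) (hD : 0 < 2 * σ ^ 2 + K * t) {x : EuclideanSpace ℝ (Fin m)}
    {y : EuclideanSpace ℝ (Fin n)} (hx : ‖x‖ = 1) (hy : ‖y‖ = 1) :
    P.real {ω | 2 * t ≤ |⟪x, toCLM (E ω) y⟫_ℝ|} ≤
      2 * Real.exp (-(t ^ 2 / (2 * σ ^ 2 + K * t))) := by
  have h := hE.isBoundedFamily.measureReal_linear_le hK (σ := σ) (fun a => hE.variance_le a.1 a.2)
    ht hD (c := fun a => x a.1 * y a.2) (le_of_eq (by
      simp_rw [mul_pow]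
      rw [Fintype.sum_prod_type]
      simp_rw [← Finset.mul_sum]
      rw [← Finset.sum_mul, sum_sq_eq_one hx, sum_sq_eq_one hy, one_mul]))
  convert h using 7 with ω
  rw [inner_eq_dotProduct, ofLp_toCLM, Fintype.sum_prod_type]
  simp only [dotProduct, Matrix.mulVec, Finset.mul_sum]
  exact Finset.sum_congr rfl fun i _ => Finset.sum_congr rfl fun j _ => by ring

/-- A Gram entry couples entries of one row with coefficients x_j y_k. As ∑ |x_j y_j| ≤ 1, its
diagonal is at most the largest squared column norm, hence at most ‖E‖²; the variance sum is at most
C by ab ≤ (a² + b²)/2. -/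
theorem measureReal_gram_le (hE : IsBoundedFamily P (fun (a : Fin m × Fin n) ω => E ω a.1 a.2) K)
    (hK : 0 ≤ K) {l t s t₂ C : ℝ} (hl : 0 ≤ l) (hlK : l * K ≤ t) (hKt : 2 * K ≤ t) (ht : 0 < t)
    (hts : 384 * t ≤ s) (ht₂ : 0 < t₂) (hC : ∀ j, ∑ i, Var[fun ω => E ω i j; P] ^ 2 ≤ C)
    {x y : EuclideanSpace ℝ (Fin n)} (hx : ‖x‖ = 1) (hy : ‖y‖ = 1) :
    P.real {ω | ‖E ω‖ ≤ s / 96 ∧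
      t₂ + |∫ ω, (E ω *ᵥ x.ofLp) ⬝ᵥ (E ω *ᵥ y.ofLp) ∂P| + t * s
        < |(E ω *ᵥ x.ofLp) ⬝ᵥ (E ω *ᵥ y.ofLp)|} ≤ 2 * C / t₂ ^ 2 + 2 * Real.exp (-l) := by
  have hx1 := sum_sq_eq_one hx
  have hy1 := sum_sq_eq_one hy
  set c : Fin m × Fin n → Fin m × Fin n → ℝ :=
    fun a b => if a.1 = b.1 then x a.2 * y b.2 else 0 with hc
  have hcaa : ∀ a, c a a = x a.2 * y a.2 := fun a => if_pos rfl
  have hle1 : ∑ j, |x j * y j| ≤ 1 := by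
    calc ∑ j, |x j * y j| ≤ ∑ j, (x j ^ 2 + y j ^ 2) / 2 := by
          refine Finset.sum_le_sum fun j _ => ?_
          rw [abs_mul]
          nlinarith [sq_nonneg (|x j| - |y j|), sq_abs (x j), sq_abs (y j)]
      _ = 1 := by rw [← Finset.sum_div, Finset.sum_add_distrib, hx1, hy1]; norm_num
  have hc1 : ∀ a, |c a a| ≤ 1 := fun a => by
    rw [hcaa]
    exact (Finset.single_le_sum (f := fun j => |x j * y j|) (fun _ _ => abs_nonneg _)
      (Finset.mem_univ a.2)).trans hle1
  have hquad : ∀ ω, ∑ a, ∑ b, c a b * (E ω a.1 a.2 * E ω b.1 b.2)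
      = (E ω *ᵥ x.ofLp) ⬝ᵥ (E ω *ᵥ y.ofLp) := by
    intro ω
    simp only [Fintype.sum_prod_type, hc, dotProduct, Matrix.mulVec, Finset.sum_mul_sum, ite_mul,
      zero_mul]
    refine Finset.sum_congr rfl fun i _ => Finset.sum_congr rfl fun j _ => ?_
    rw [Finset.sum_eq_single i]
    · exact Finset.sum_congr rfl fun k _ => by rw [if_pos rfl]; ring
    · intro k _ hk
      exact Finset.sum_eq_zero fun _ _ => if_neg hk.symm
    · simp
  have hvar : ∑ a, ∑ b, c a b ^ 2 *
      (Var[fun ω => E ω a.1 a.2; P] * Var[fun ω => E ω b.1 b.2; P]) ≤ C := by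
    set V : Fin m → Fin n → ℝ := fun i j => Var[fun ω => E ω i j; P] with hV
    have h1 : ∑ a, ∑ b, c a b ^ 2 *
        (Var[fun ω => E ω a.1 a.2; P] * Var[fun ω => E ω b.1 b.2; P])
        = ∑ i, ∑ j, ∑ k, x j ^ 2 * y k ^ 2 * (V i j * V i k) := by
      simp only [Fintype.sum_prod_type, hc, ite_pow, ite_mul]
      refine Finset.sum_congr rfl fun i _ => Finset.sum_congr rfl fun j _ => ?_
      rw [Finset.sum_eq_single i]
      · exact Finset.sum_congr rfl fun k _ => by rw [if_pos rfl, mul_pow]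
      · intro k _ hk
        exact Finset.sum_eq_zero fun _ _ => by rw [if_neg hk.symm]; ring
      · simp
    rw [h1, Finset.sum_comm]
    have h2 : ∀ j k, ∑ i, V i j * V i k ≤ C := fun j k => by
      calc ∑ i, V i j * V i k ≤ ∑ i, (V i j ^ 2 + V i k ^ 2) / 2 :=
            Finset.sum_le_sum fun i _ => by nlinarith [sq_nonneg (V i j - V i k)]
        _ ≤ C := by
            rw [← Finset.sum_div, Finset.sum_add_distrib]
            linarith [hC j, hC k]
    calc ∑ j, ∑ i, ∑ k, x j ^ 2 * y k ^ 2 * (V i j * V i k)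
        = ∑ j, ∑ k, x j ^ 2 * y k ^ 2 * ∑ i, V i j * V i k := by
          refine Finset.sum_congr rfl fun j _ => ?_
          rw [Finset.sum_comm]
          simp_rw [Finset.mul_sum]
      _ ≤ ∑ j, ∑ k, x j ^ 2 * y k ^ 2 * C := by
          gcongr with j _ k _
          exact h2 j k
      _ = C := by
          simp_rw [← Finset.sum_mul, ← Finset.mul_sum]
          rw [hy1, ← Finset.sum_mul, hx1]
          ring
  have hb := hE.measureReal_quadratic_le hc1 hK hl hlK hKt ht hts ht₂
  simp_rw [hquad] at hb
  refine (measureReal_mono ?_).trans (hb.trans ?_)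
  · rintro ω ⟨h1, h2⟩
    refine ⟨?_, h2⟩
    have h3 : ‖E ω‖ ^ 2 ≤ s ^ 2 / 96 ^ 2 := by
      rw [← div_pow]
      gcongr
    calc ∑ a : Fin m × Fin n, |c a a| * E ω a.1 a.2 ^ 2
        = ∑ j, |x j * y j| * ∑ i, E ω i j ^ 2 := by
          rw [Fintype.sum_prod_type, Finset.sum_comm]
          simp_rw [hcaa, Finset.mul_sum]
      _ ≤ ∑ j, |x j * y j| * ‖E ω‖ ^ 2 := by
          gcongr with j _
          exact sum_column_sq_le _ j
      _ = (∑ j, |x j * y j|) * ‖E ω‖ ^ 2 := by rw [Finset.sum_mul]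
      _ ≤ 1 * ‖E ω‖ ^ 2 := by gcongr
      _ ≤ _ := by linarith
  · gcongr

end RandomMatrices

/-! ### The bound for matrix truncations under (C0) -/

section MainResults

variable {m n : ℕ}

theorem SVD.norm_approx_sub_le {A E : Matrix (Fin m) (Fin n) ℝ} (S : SVD A) (T : SVD (A + E))
    {p : ℕ} (hp : 1 ≤ p) (hpr : p ≤ A.rank) (hgap : 0 < gap A p) {t y : ℝ} (ht : 0 ≤ t)
    (hy : 0 ≤ y) (hx : ∀ l k, |⟪S.u l, toCLM E (S.v k)⟫_ℝ| ≤ t)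
    (hyu : ∀ l k, l ≠ k → |(Eᵀ *ᵥ (S.u l).ofLp) ⬝ᵥ (Eᵀ *ᵥ (S.u k).ofLp)| ≤ y)
    (hyv : ∀ l k, l ≠ k → |(E *ᵥ (S.v l).ofLp) ⬝ᵥ (E *ᵥ (S.v k).ofLp)| ≤ y)
    (hc₁ : p * ‖E‖ ≤ sval A p / 96) (hc₂ : (A.rank : ℝ) ^ 2 * t ≤ gap A p / 48)
    (hc₃ : A.rank * ‖E‖ ^ 2 ≤ sval A p * gap A p / 96 ^ 2) :
    ‖T.approx p - S.approx p‖ ≤ 49 / 8 * (A.rank * t * sval A p / gap A p)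
      + 6 * (A.rank * y / gap A p) + 5 * ‖E‖ := by
  have hσ0 := sval_nonneg A p
  rw [← norm_toCLM, map_sub, S.toCLM_approx, T.toCLM_approx]
  refine ContinuousLinearMap.opNorm_le_bound _ (by positivity) fun z => ?_
  rw [sub_apply]
  refine norm_truncation_sub_le_of_interaction hp hpr S.orthonormal_u S.orthonormal_v
    T.orthonormal_u T.orthonormal_v (fun i j h => sval_antitone _ (by
      have : i.val ≤ j.val := h
      omega)) (fun i => sval_nonneg _ _) (E := toCLM E) (by
      rw [← S.toCLM_eq, ← T.toCLM_eq, map_add]) (norm_nonneg E) (toCLM E).le_opNorm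
    (fun w => ?_) ht hy (fun i => sval_nonneg _ _) (sval_nonneg A (p + 1)) (sub_pos.mp hgap)
    (fun i hi => sval_antitone A hi) (fun i hi => sval_antitone A (by omega)) hx
    (fun l k hlk => ?_) (fun l k hlk => ?_) hc₁ hc₂ hc₃ z
  · rw [adjoint_toCLM, ← norm_transpose]
    exact (toCLM Eᵀ).le_opNorm w
  · rw [adjoint_toCLM, inner_eq_dotProduct]
    exact hyu l k hlk
  · rw [inner_eq_dotProduct]
    exact hyv l k hlk

theorem sval_pos {A : Matrix (Fin m) (Fin n) ℝ} {p : ℕ} (hgap : 0 < gap A p) : 0 < sval A p :=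
  (sval_nonneg A (p + 1)).trans_lt (sub_pos.mp hgap)

theorem gap_le_sval (A : Matrix (Fin m) (Fin n) ℝ) (p : ℕ) : gap A p ≤ sval A p :=
  sub_le_self _ (sval_nonneg A (p + 1))

theorem CondC0.norm_le {A E : Matrix (Fin m) (Fin n) ℝ} {p : ℕ} {t : ℝ} (hgap : 0 < gap A p)
    (h : CondC0 A E p t) : p * ‖E‖ ≤ sval A p / 96 := by
  have h1 := ((le_max_left _ _).trans (le_max_left _ _)).trans h
  rw [eps₁, mul_div_assoc', div_le_iff₀ (sval_pos hgap)] at h1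
  linarith

theorem CondC0.threshold_le {A E : Matrix (Fin m) (Fin n) ℝ} {p : ℕ} {t : ℝ} (hgap : 0 < gap A p)
    (h : CondC0 A E p t) : (A.rank : ℝ) ^ 2 * t ≤ gap A p / 96 := by
  have h1 := ((le_max_right _ _).trans (le_max_left _ _)).trans h
  rw [eps₂, mul_one_div, div_le_iff₀ hgap] at h1
  linarith

theorem CondC0.norm_sq_le {A E : Matrix (Fin m) (Fin n) ℝ} {p : ℕ} {t : ℝ} (hgap : 0 < gap A p)
    (h : CondC0 A E p t) : A.rank * ‖E‖ ^ 2 ≤ sval A p * gap A p / 96 ^ 2 := by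
  have h1 := (le_max_right _ _).trans h
  have hpos := mul_pos (sval_pos hgap) hgap
  rw [Real.sqrt_le_left (by norm_num), eta, mul_div_assoc', div_le_iff₀ hpos] at h1
  linarith

theorem error_bound_eq {σ δ e r t b : ℝ} (hσ : 0 < σ) (he : e ≠ 0) :
    32 * σ * (e / σ + r * t * (1 / δ) + r ^ 2 * b / e * (e / σ) * (1 / δ))
      = 32 * (r * t * σ / δ) + 32 * (r ^ 2 * b / δ) + 32 * e := by
  field_simp
  ring

variable {Ω : Type*} [MeasurableSpace Ω]

theorem abs_add_abs_le_meanSkew (P : Measure Ω) (E : Ω → Matrix (Fin m) (Fin n) ℝ)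
    {A : Matrix (Fin m) (Fin n) ℝ} (S : SVD A) {k l : Fin A.rank} (h : k < l) :
    |∫ ω, (E ω *ᵥ (S.v k).ofLp) ⬝ᵥ (E ω *ᵥ (S.v l).ofLp) ∂P| +
      |∫ ω, ((E ω)ᵀ *ᵥ (S.u k).ofLp) ⬝ᵥ ((E ω)ᵀ *ᵥ (S.u l).ofLp) ∂P| ≤ meanSkew P E S :=
  le_ciSup (f := fun a : {a : Fin A.rank × Fin A.rank // a.1 < a.2} =>
    |∫ ω, (E ω *ᵥ (S.v a.1.1).ofLp) ⬝ᵥ (E ω *ᵥ (S.v a.1.2).ofLp) ∂P| +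
      |∫ ω, ((E ω)ᵀ *ᵥ (S.u a.1.1).ofLp) ⬝ᵥ ((E ω)ᵀ *ᵥ (S.u a.1.2).ofLp) ∂P|)
    (Set.finite_range _).bddAbove ⟨(k, l), h⟩

theorem meanSkew_nonneg (P : Measure Ω) (E : Ω → Matrix (Fin m) (Fin n) ℝ)
    {A : Matrix (Fin m) (Fin n) ℝ} (S : SVD A) : 0 ≤ meanSkew P E S :=
  Real.iSup_nonneg fun _ => by positivity

/-- The claimed error bound, under `CondC0` for the value `E` of the noise. -/
theorem approx_error_le {A E : Matrix (Fin m) (Fin n) ℝ} (S : SVD A) (T : SVD (A + E)) {p : ℕ}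
    (hp : 1 ≤ p) (hpr : p ≤ A.rank) (hgap : 0 < gap A p) {t b : ℝ} (ht : 0 ≤ t) (hb : 0 ≤ b)
    (hC : CondC0 A E p t)
    (hx : A.rank = 1 ∨ ∀ l k, |⟪S.u l, toCLM E (S.v k)⟫_ℝ| ≤ 2 * t)
    (hyu : ∀ l k, l < k → |(Eᵀ *ᵥ (S.u l).ofLp) ⬝ᵥ (Eᵀ *ᵥ (S.u k).ofLp)| ≤ b + t * sval A p)
    (hyv : ∀ l k, l < k → |(E *ᵥ (S.v l).ofLp) ⬝ᵥ (E *ᵥ (S.v k).ofLp)| ≤ b + t * sval A p) :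
    ‖T.approx p - S.approx p‖ ≤ 32 * sval A p * (eps₁ A E p + A.rank * t * eps₂ A p
      + (A.rank : ℝ) ^ 2 * b / ‖E‖ * eps₁ A E p * eps₂ A p) := by
  have hσ := sval_pos hgap
  have hr1 : (1 : ℝ) ≤ A.rank := by exact_mod_cast hp.trans hpr
  have hc₁ := hC.norm_le hgap
  have hc₂ := hC.threshold_le hgap
  have hc₃ := hC.norm_sq_le hgap
  have hEx : ∀ l k, |⟪S.u l, toCLM E (S.v k)⟫_ℝ| ≤ ‖E‖ := fun l k => by
    refine (abs_real_inner_le_norm _ _).trans ?_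
    rw [S.orthonormal_u.1 l, one_mul]
    refine ((toCLM E).le_opNorm _).trans ?_
    rw [S.orthonormal_v.1 k, mul_one, norm_toCLM]
  -- Division by ‖E‖ = 0 has value 0, so no help comes from the last summand; the deterministic
  -- bound itself is 0 here.
  rcases eq_or_ne E 0 with h0 | h0
  · have h1 := S.norm_approx_sub_le T hp hpr hgap (t := 0) (y := 0) le_rfl le_rfl
      (fun l k => (hEx l k).trans (by simp [h0])) (fun l k _ => by simp [h0])
      (fun l k _ => by simp [h0]) hc₁ (by rw [mul_zero]; positivity) hc₃
    have h2 : ‖E‖ = 0 := by rw [h0, norm_zero]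
    rw [h2] at h1
    simp only [mul_zero, zero_mul, zero_div, add_zero] at h1
    refine h1.trans ?_
    rw [eps₁, eps₂]
    positivity
  have he : 0 < ‖E‖ := norm_pos_iff.mpr h0
  rw [eps₁, eps₂, error_bound_eq hσ he.ne']
  have hX : 0 ≤ A.rank * t * sval A p / gap A p := by positivity
  have hB : 0 ≤ (A.rank : ℝ) ^ 2 * b / gap A p := by positivity
  -- In rank one δ_1 = σ_1, so the trivial bound t = ‖E‖ contributes only a multiple of ‖E‖, which
  -- the ε₁ term absorbs without probability.
  by_cases hr : A.rank = 1
  · have hss : ∀ l k : Fin A.rank, l = k := fun l k => Fin.ext (by omega)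
    have hp1 : p = 1 := by omega
    have hgapσ : gap A p = sval A p := by
      have : sval A (p + 1) = 0 := by
        obtain ⟨S⟩ := SVD.nonempty A
        rw [sval, LinearMap.singularValues_eq_zero_iff_le_finrank_range]
        have hrank : A.rank = Module.finrank ℝ (LinearMap.range (Matrix.toEuclideanLin A)) := by
          rw [Matrix.toEuclideanLin, Matrix.toLpLin_eq_toLin]
          exact Matrix.rank_eq_finrank_range_toLin A _ _
        omega
      rw [gap, this, sub_zero]
    have h1 := S.norm_approx_sub_le T hp hpr hgap (t := ‖E‖) (y := 0) he.le le_rfl hEx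
      (fun l k h => absurd (hss l k) h) (fun l k h => absurd (hss l k) h) hc₁ (by
        rw [hr, hgapσ]
        rw [hp1] at hc₁ ⊢
        push_cast at hc₁ ⊢
        linarith) hc₃
    have h2 : A.rank * ‖E‖ * sval A p / gap A p = ‖E‖ := by
      rw [hr, hgapσ]
      field_simp
      simp
    rw [h2] at h1
    simp only [mul_zero, zero_div, add_zero] at h1
    linarith
  · have hx := hx.resolve_left hr
    -- Both 2t and the summand t σ_p of y feed the term r t σ_p/δ_p, with total coefficient 2 · 49/8
    -- + 6 < 32.
    have hpos : 0 ≤ b + t * sval A p := by positivity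
    have h1 := S.norm_approx_sub_le T hp hpr hgap (t := 2 * t) (y := b + t * sval A p)
      (by positivity) hpos hx
      (fun l k h => by
        rcases lt_or_gt_of_ne h with h | h
        · exact hyu l k h
        · rw [dotProduct_comm]
          exact hyu k l h)
      (fun l k h => by
        rcases lt_or_gt_of_ne h with h | h
        · exact hyv l k h
        · rw [dotProduct_comm]
          exact hyv k l h) hc₁ (by linarith) hc₃
    have h2 : A.rank * (2 * t) * sval A p / gap A p = 2 * (A.rank * t * sval A p / gap A p) := by
      ring
    have h3 : A.rank * (b + t * sval A p) / gap A p
        = A.rank * b / gap A p + A.rank * t * sval A p / gap A p := by ring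
    have h4 : A.rank * b / gap A p ≤ (A.rank : ℝ) ^ 2 * b / gap A p := by
      gcongr
      nlinarith
    rw [h2, h3] at h1
    linarith

end MainResults

/-! ### The exceptional event -/

section Event

variable {m n : ℕ} {Ω : Type*} [MeasurableSpace Ω]

theorem IsBoundedNoise.nonneg {P : Measure Ω} [IsProbabilityMeasure P]
    {E : Ω → Matrix (Fin m) (Fin n) ℝ} {K σ : ℝ} (hE : IsBoundedNoise P E K σ) (hm : 0 < m)
    (hn : 0 < n) : 0 ≤ K := by
  obtain ⟨ω, h⟩ := hE.bounded.exists
  exact (abs_nonneg _).trans (h ⟨0, hm⟩ ⟨0, hn⟩)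

/-- Outside an event of small probability, the noise has small interaction with the singular
vectors whenever its norm is small. -/
theorem exists_interaction_event (hmn : m ≤ n) (P : Measure Ω) [IsProbabilityMeasure P]
    {A : Matrix (Fin m) (Fin n) ℝ} (S : SVD A) (hr : 2 ≤ A.rank)
    {E : Ω → Matrix (Fin m) (Fin n) ℝ} {K σ : ℝ} (hE : IsBoundedNoise P E K σ) {t₁ t₂ s : ℝ}
    (ht₁ : 0 < t₁) (ht₂ : 0 < t₂) (hts : 384 * t₁ ≤ s)
    (hq : (A.rank : ℝ) ^ 2 * Real.exp (-(t₁ ^ 2 / 2) / (2 * σ ^ 2 + K * t₁)) < 1) :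
    ∃ B : Set Ω, P.real B ≤
        (A.rank : ℝ) ^ 2 * Real.exp (-(t₁ ^ 2 / 2) / (2 * σ ^ 2 + K * t₁))
          + 5 * (A.rank : ℝ) * ((A.rank : ℝ) - 1) * n * mFour P E / (2 * t₂ ^ 2) ∧
      ∀ ω ∉ B, ‖E ω‖ ≤ s / 96 →
        (∀ l k, |⟪S.u l, toCLM (E ω) (S.v k)⟫_ℝ| ≤ 2 * t₁) ∧
        (∀ l k, l < k → |((E ω)ᵀ *ᵥ (S.u l).ofLp) ⬝ᵥ ((E ω)ᵀ *ᵥ (S.u k).ofLp)| ≤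
          t₂ + meanSkew P E S + t₁ * s) ∧
        ∀ l k, l < k → |(E ω *ᵥ (S.v l).ofLp) ⬝ᵥ (E ω *ᵥ (S.v k).ofLp)| ≤
          t₂ + meanSkew P E S + t₁ * s := by
  have hm : 0 < m := by
    have : A.rank ≤ m := by simpa using A.rank_le_card_height
    omega
  have hn : 0 < n := by omega
  have hK := hE.nonneg hm hn
  have hr2 : (2 : ℝ) ≤ A.rank := by exact_mod_cast hr
  set r : ℝ := (A.rank : ℝ) with hrdef
  set D := 2 * σ ^ 2 + K * t₁ with hDdef
  set q := Real.exp (-(t₁ ^ 2 / 2) / D) with hqdef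
  have hq0 : 0 < q := Real.exp_pos _
  have hr4 : 4 ≤ r ^ 2 := by nlinarith
  have hq4 : q < 1 / 4 := by nlinarith
  -- If D = 0, division by zero makes the exponential equal to 1, against q < 1/4.
  have hD : 0 < D := by
    refine lt_of_le_of_ne (by positivity) fun h => ?_
    rw [hqdef, ← h, div_zero, Real.exp_zero] at hq4
    norm_num at hq4
  set l := t₁ ^ 2 / D with hl
  have hql : Real.exp (-l) = q ^ 2 := by
    rw [hqdef, ← Real.exp_nat_mul, hl]
    congr 1
    push_cast
    ring
  have hl0 : 0 ≤ l := by positivity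
  have hlK : l * K ≤ t₁ := by
    rw [hl, div_mul_eq_mul_div, div_le_iff₀ hD]
    nlinarith [mul_nonneg ht₁.le (sq_nonneg σ)]
  -- From exp(-l/2) = q < 1/4 < exp(-1). With l K ≤ t₁ this yields 2K ≤ t₁.
  have hl2 : 2 ≤ l := by
    by_contra h
    push Not at h
    have h1 : Real.exp (-1) ≤ q := by
      rw [hqdef, Real.exp_le_exp]
      have : -(t₁ ^ 2 / 2) / D = -(l / 2) := by rw [hl]; ring
      rw [this]
      linarith
    have h2 : 1 / 4 < Real.exp (-1) := by
      rw [Real.exp_neg, one_div]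
      exact (inv_lt_inv₀ (by norm_num) (Real.exp_pos 1)).mpr
        (Real.exp_one_lt_d9.trans (by norm_num))
    linarith
  have hKt : 2 * K ≤ t₁ := by nlinarith
  set C : ℝ := n * mFour P E with hC
  have hC0 : 0 ≤ C := mul_nonneg (Nat.cast_nonneg n) mFour_nonneg
  let Bx : Fin A.rank × Fin A.rank → Set Ω := fun a =>
    {ω | 2 * t₁ ≤ |⟪S.u a.1, toCLM (E ω) (S.v a.2)⟫_ℝ|}
  -- The norm constraint belongs to the bad event, since the diagonal estimate needs it; (C0) will
  -- supply it.
  let Bv : {a : Fin A.rank × Fin A.rank // a.1 < a.2} → Set Ω := fun a =>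
    {ω | ‖E ω‖ ≤ s / 96 ∧
      t₂ + |∫ ω, (E ω *ᵥ (S.v a.1.1).ofLp) ⬝ᵥ (E ω *ᵥ (S.v a.1.2).ofLp) ∂P| + t₁ * s
        < |(E ω *ᵥ (S.v a.1.1).ofLp) ⬝ᵥ (E ω *ᵥ (S.v a.1.2).ofLp)|}
  let Bu : {a : Fin A.rank × Fin A.rank // a.1 < a.2} → Set Ω := fun a =>
    {ω | ‖(E ω)ᵀ‖ ≤ s / 96 ∧
      t₂ + |∫ ω, ((E ω)ᵀ *ᵥ (S.u a.1.1).ofLp) ⬝ᵥ ((E ω)ᵀ *ᵥ (S.u a.1.2).ofLp) ∂P| + t₁ * s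
        < |((E ω)ᵀ *ᵥ (S.u a.1.1).ofLp) ⬝ᵥ ((E ω)ᵀ *ᵥ (S.u a.1.2).ofLp)|}
  have hBx : ∀ a, P.real (Bx a) ≤ 2 * q ^ 2 := fun a => by
    rw [← hql]
    exact hE.measureReal_bilinear_le hK ht₁ hD (S.orthonormal_u.1 a.1) (S.orthonormal_v.1 a.2)
  have hBv : ∀ a, P.real (Bv a) ≤ 2 * C / t₂ ^ 2 + 2 * q ^ 2 := fun a => by
    rw [← hql]
    exact measureReal_gram_le hE.isBoundedFamily hK hl0 hlK hKt ht₁ hts ht₂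
      (sum_column_variance_le hm hmn) (S.orthonormal_v.1 a.1.1) (S.orthonormal_v.1 a.1.2)
  have hBu : ∀ a, P.real (Bu a) ≤ 2 * C / t₂ ^ 2 + 2 * q ^ 2 := fun a => by
    rw [← hql]
    exact measureReal_gram_le (E := fun ω => (E ω)ᵀ) hE.isBoundedFamily_transpose hK hl0 hlK hKt
      ht₁ hts ht₂ (sum_row_variance_le hn) (S.orthonormal_u.1 a.1.1) (S.orthonormal_u.1 a.1.2)
  refine ⟨(⋃ a, Bx a) ∪ ⋃ a, (Bv a ∪ Bu a), ?_, ?_⟩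
  · have h1 : P.real (⋃ a, Bx a) ≤ r ^ 2 * (2 * q ^ 2) := by
      refine (measureReal_iUnion_fintype_le _).trans
        ((Finset.sum_le_sum fun a _ => hBx a).trans (le_of_eq ?_))
      simp [hrdef, pow_two]
    have h2 : P.real (⋃ a, (Bv a ∪ Bu a)) ≤
        r * (r - 1) / 2 * (2 * (2 * C / t₂ ^ 2 + 2 * q ^ 2)) := by
      refine (measureReal_iUnion_fintype_le _).trans ((Finset.sum_le_sum fun a _ =>
        (measureReal_union_le _ _).trans (add_le_add (hBv a) (hBu a))).trans (le_of_eq ?_))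
      rw [Finset.sum_const, nsmul_eq_mul, Finset.card_univ, card_lt_pairs]
      ring
    refine (measureReal_union_le _ _).trans ((add_le_add h1 h2).trans ?_)
    have h3 : r ^ 2 * (2 * q ^ 2) + r * (r - 1) / 2 * (2 * (2 * C / t₂ ^ 2 + 2 * q ^ 2))
        = (4 * r ^ 2 - 2 * r) * q ^ 2 + 4 * r * (r - 1) * C / (2 * t₂ ^ 2) := by
      field_simp
      ring
    rw [h3]
    -- All exponential tails are 2q², so q < 1/4 pays for the r² bilinear and r (r - 1) Gram events.
    have h4 : (4 * r ^ 2 - 2 * r) * q ^ 2 ≤ r ^ 2 * q := by nlinarith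
    have h5 : 4 * r * (r - 1) * C / (2 * t₂ ^ 2) ≤
        5 * r * (r - 1) * n * mFour P E / (2 * t₂ ^ 2) := by
      refine div_le_div_of_nonneg_right ?_ (by positivity)
      have : 0 ≤ r * (r - 1) * C := mul_nonneg (mul_nonneg (by linarith) (by linarith)) hC0
      have h6 : 5 * r * (r - 1) * n * mFour P E = 5 * (r * (r - 1) * C) := by rw [hC]; ring
      rw [h6]
      linarith
    linarith
  · intro ω hω hn
    simp only [Set.mem_union, Set.mem_iUnion, not_or, not_exists] at hω
    obtain ⟨hω₁, hω₂⟩ := hω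
    refine ⟨fun l k => ?_, fun l k h => ?_, fun l k h => ?_⟩
    · exact (not_le.mp (hω₁ (l, k))).le
    · have h1 := (hω₂ ⟨(l, k), h⟩).2
      by_contra h2
      refine h1 ⟨by rwa [norm_transpose], lt_of_le_of_lt ?_ (not_le.mp h2)⟩
      have := abs_add_abs_le_meanSkew P E S h
      linarith [abs_nonneg (∫ ω, (E ω *ᵥ (S.v l).ofLp) ⬝ᵥ (E ω *ᵥ (S.v k).ofLp) ∂P)]
    · have h1 := (hω₂ ⟨(l, k), h⟩).1
      by_contra h2
      refine h1 ⟨hn, lt_of_le_of_lt ?_ (not_le.mp h2)⟩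
      have := abs_add_abs_le_meanSkew P E S h
      linarith [abs_nonneg (∫ ω, ((E ω)ᵀ *ᵥ (S.u l).ofLp) ⬝ᵥ ((E ω)ᵀ *ᵥ (S.u k).ofLp) ∂P)]

end Event

end LowRankPerturbation

/-! ### The main theorem -/

theorem mainTheorem6 {m n : ℕ} (hmn : m ≤ n)
    {Ω : Type*} [MeasurableSpace Ω] (P : Measure Ω) [IsProbabilityMeasure P]
    (A : Matrix (Fin m) (Fin n) ℝ) (S : LowRankPerturbation.SVD A)
    (p : ℕ) (hp : 1 ≤ p) (hpr : p ≤ A.rank) (hgap : 0 < LowRankPerturbation.gap A p)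
    (E : Ω → Matrix (Fin m) (Fin n) ℝ) (K σ : ℝ)
    (hE : LowRankPerturbation.IsBoundedNoise P E K σ)
    (t₁ t₂ : ℝ) (ht₁ : 0 < t₁) (ht₂ : 0 < t₂) :
    ∃ G : Set Ω, MeasurableSet G ∧
      1 - (A.rank : ℝ) ^ 2 * Real.exp (-(t₁ ^ 2 / 2) / (2 * σ ^ 2 + K * t₁))
          - 5 * (A.rank : ℝ) * ((A.rank : ℝ) - 1) * n * LowRankPerturbation.mFour P E
            / (2 * t₂ ^ 2)
        ≤ P.real G ∧
      ∀ ω ∈ G, LowRankPerturbation.CondC0 A (E ω) p t₁ →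
        ∀ T : LowRankPerturbation.SVD (A + E ω),
          ‖T.approx p - S.approx p‖ ≤
            32 * LowRankPerturbation.sval A p *
              (LowRankPerturbation.eps₁ A (E ω) p
                + A.rank * t₁ * LowRankPerturbation.eps₂ A p
                + (A.rank : ℝ) ^ 2 * (t₂ + LowRankPerturbation.meanSkew P E S) / ‖E ω‖
                  * LowRankPerturbation.eps₁ A (E ω) p * LowRankPerturbation.eps₂ A p) := by
  open LowRankPerturbation in
  have hr1 : (1 : ℝ) ≤ A.rank := by exact_mod_cast hp.trans hpr
  have hμ := meanSkew_nonneg P E S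
  have hexp : 0 ≤ (A.rank : ℝ) ^ 2 * Real.exp (-(t₁ ^ 2 / 2) / (2 * σ ^ 2 + K * t₁)) := by
    positivity
  have hfour : 0 ≤ 5 * (A.rank : ℝ) * ((A.rank : ℝ) - 1) * n * mFour P E / (2 * t₂ ^ 2) := by
    have h1 : (0 : ℝ) ≤ (A.rank : ℝ) - 1 := by linarith
    have h2 : 0 ≤ mFour P E := mFour_nonneg
    positivity
  -- This part of (C0) is deterministic; if it fails, (C0) holds for no outcome.
  by_cases hthr : (A.rank : ℝ) ^ 2 * t₁ ≤ gap A p / 96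
  swap
  · refine ⟨Set.univ, MeasurableSet.univ, ?_, fun ω _ hC => absurd (hC.threshold_le hgap) hthr⟩
    rw [probReal_univ]
    linarith
  -- Rank one is deterministic; there a nontrivial bound only gives q < 1, too weak to pay for the
  -- union bound.
  by_cases hr : A.rank = 1
  · refine ⟨Set.univ, MeasurableSet.univ, ?_, fun ω _ hC T => ?_⟩
    · rw [probReal_univ]
      linarith
    · refine approx_error_le S T hp hpr hgap ht₁.le (by positivity) hC (Or.inl hr)
        (fun l k h => ?_) (fun l k h => ?_)
      all_goals
        have h1 : l.val < k.val := h
        omega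
  by_cases hq : (A.rank : ℝ) ^ 2 * Real.exp (-(t₁ ^ 2 / 2) / (2 * σ ^ 2 + K * t₁)) < 1
  swap
  · refine ⟨∅, MeasurableSet.empty, ?_, fun ω h => absurd h (Set.notMem_empty ω)⟩
    rw [measureReal_empty]
    linarith
  have hr2 : 2 ≤ A.rank := by omega
  have hr2' : (2 : ℝ) ≤ A.rank := by exact_mod_cast hr2
  -- 384 = 4 · 96, from r² ≥ 4 and r² t₁ ≤ δ_p/96 ≤ σ_p/96.
  have hts : 384 * t₁ ≤ sval A p := by
    have : 4 * t₁ ≤ (A.rank : ℝ) ^ 2 * t₁ := by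
      gcongr
      nlinarith
    linarith [gap_le_sval A p]
  obtain ⟨B, hB, hgood⟩ := exists_interaction_event hmn P S hr2 hE ht₁ ht₂ hts hq
  -- A measurable hull of the same measure makes the good event measurable without examining `B`.
  refine ⟨(toMeasurable P B)ᶜ, (measurableSet_toMeasurable P B).compl, ?_, fun ω hω hC T => ?_⟩
  · rw [probReal_compl_eq_one_sub (measurableSet_toMeasurable P B)]
    have : P.real (toMeasurable P B) = P.real B := by
      rw [measureReal_def, measureReal_def, measure_toMeasurable]
    linarith
  · have hEn : ‖E ω‖ ≤ sval A p / 96 := by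
      have h1 : (1 : ℝ) ≤ p := by exact_mod_cast hp
      have := hC.norm_le hgap
      nlinarith [norm_nonneg (E ω)]
    obtain ⟨h1, h2, h3⟩ := hgood ω (fun h => hω (subset_toMeasurable P B h)) hEn
    exact approx_error_le S T hp hpr hgap ht₁.le (by positivity) hC (Or.inr h1) h2 h3
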